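/- Let $k\ge 0$ be a constant. An $n\times m$ matrix $M$ whose entries are numbers or $\infty$ is $k$-concise if the finite entries of each column of $M$ consist of at most $k$ intervals (sets of consecutive rows) of identical numbers. A concise representation of such a matrix lists, for each column, at most $k$ triples (starting row index, ending row index, common value of the interval), where a triple whose starting index exceeds its ending index stands for an empty interval. It takes $O(n+m)$ time to compute the row minima of any $n\times m$ matrix that is $k$-concise and given in concise representation; the constant in the $O$-notation depends only on $k$. Precisely: there is one program for the unit-cost RAM that solves the problem for every $k$, every $n$, $m$, and every such matrix. Its indices and counters are nonnegative integers of $w$ bits, for any $w\ge c_k\log_2(n+m+2)$ (logarithm rounded down to an integer), with constant-time addition, truncated subtraction, multiplication, integer division, comparison and indirect addressing. The matrix entries come from an arbitrary totally ordered set extended by $\infty$ and are only copied and compared. The program halts within $c_k(n+m+1)$ steps, where $c_k$ depends only on $k$, and outputs $\min_j M(i,j)$ for every row $i$ (which is $\infty$ if row $i$ has no finite entry). -/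

import Mathlib

namespace RowMinima

/-! ### Concise matrices and their concise representation -/

/-- One interval of identical finite entries in a column: rows `first, …, last` (rows are numbered
from `1`) all hold the finite number `value`.  If `last < first`, the interval is empty. -/
structure ColInterval (α : Type*) where
  first : ℕ
  last : ℕ
  value : α

/-- The list `L` of intervals describes the column `col` of an `n`-row matrix: a row holds the
finite number `v` exactly if it lies in an interval of `L` with value `v`; every row outside of all
the intervals holds `∞ = ⊤`.  (Index `i : Fin n` is row number `i + 1`.) -/
def DescribesColumn {α : Type*} {n : ℕ} (L : List (ColInterval α)) (col : Fin n → WithTop α) : Prop :=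
  (∀ I ∈ L, 1 ≤ I.first ∧ I.first ≤ n + 1 ∧ I.last ≤ n) ∧
  ∀ (i : Fin n) (v : α),
    col i = (v : WithTop α) ↔
      ∃ I ∈ L, I.first ≤ (i : ℕ) + 1 ∧ (i : ℕ) + 1 ≤ I.last ∧ I.value = v

/-- `M` is `k`-concise: the finite entries of each column of `M` consist of at most `k` intervals of
identical numbers. -/
def IsConcise {α : Type*} {n m : ℕ} (k : ℕ) (M : Matrix (Fin n) (Fin m) (WithTop α)) : Prop :=
  ∀ j, ∃ L : List (ColInterval α), L.length ≤ k ∧ DescribesColumn L (fun i => M i j)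

/-- `R` is a concise representation of the `k`-concise matrix `M`: it lists, for each column, at
most `k` intervals (three numbers each) that describe the column. -/
def IsConciseRep {α : Type*} {n m : ℕ} (k : ℕ) (M : Matrix (Fin n) (Fin m) (WithTop α))
    (R : Fin m → List (ColInterval α)) : Prop :=
  ∀ j, (R j).length ≤ k ∧ DescribesColumn (R j) (fun i => M i j)

/-- The minimum of row `i` (it is `∞` if there are no columns). -/
def rowMin {α : Type*} [LinearOrder α] {n m : ℕ} (M : Matrix (Fin n) (Fin m) (WithTop α))
    (i : Fin n) : WithTop α :=
  Finset.univ.inf (fun j => M i j)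

/-! ### The machine: a unit-cost word RAM

There are two kinds of memory cells: *words*, which hold `w`-bit natural numbers (indices, counters),
and *entries*, which hold matrix entries.  Entries can only be copied and compared.
Programs are finite; they use finitely many word registers, word arrays and entry arrays, which
are named by numerals.  A cell of an array is addressed by a computed word. -/

/-- Memory contents: word registers, word arrays, entry arrays. -/
structure State (α : Type*) where
  reg : ℕ → ℕ
  arr : ℕ → ℕ → ℕ
  ent : ℕ → ℕ → WithTop α

/-- Arithmetical operations on words: sum, truncated difference, product, integer quotient. -/
inductive Op where
  | add | sub | mul | div

/-- The result of an operation; dividing by zero is an error. -/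
def Op.apply : Op → ℕ → ℕ → Option ℕ
  | .add, x, y => some (x + y)
  | .sub, x, y => some (x - y)
  | .mul, x, y => some (x * y)
  | .div, x, y => if y = 0 then none else some (x / y)

/-- Word expressions: a constant, a register, an array cell, an operation. -/
inductive WExp where
  | const (v : ℕ)
  | reg (x : ℕ)
  | cell (A : ℕ) (e : WExp)
  | op (o : Op) (e₁ e₂ : WExp)

/-- Entry expressions: `∞`, or a cell of an entry array. -/
inductive EExp where
  | top
  | cell (A : ℕ) (e : WExp)

/-- Tests: comparisons of words, comparison of entries, negation, conjunction. -/
inductive Test where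
  | lt (e₁ e₂ : WExp)
  | eq (e₁ e₂ : WExp)
  | entLt (u₁ u₂ : EExp)
  | not (b : Test)
  | and (b₁ b₂ : Test)

/-- Programs. -/
inductive Prog where
  | skip
  | setReg (x : ℕ) (e : WExp)
  | setArr (A : ℕ) (i e : WExp)
  | setEnt (A : ℕ) (i : WExp) (u : EExp)
  | seq (p q : Prog)
  | ite (b : Test) (p q : Prog)
  | while (b : Test) (p : Prog)

/-- `fits w v` is the word `v`, or an error (overflow) if `v` does not fit into `w` bits. -/
def fits (w v : ℕ) : Option ℕ := if v < 2 ^ w then some v else none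

/-- The value of a word expression; every value that is read or computed must fit into a `w`-bit
word, otherwise the evaluation fails. -/
def WExp.eval {α : Type*} (w : ℕ) (s : State α) : WExp → Option ℕ
  | .const v => fits w v
  | .reg x => fits w (s.reg x)
  | .cell A e => (e.eval w s).bind fun i => fits w (s.arr A i)
  | .op o e₁ e₂ =>
      (e₁.eval w s).bind fun x => (e₂.eval w s).bind fun y => (o.apply x y).bind (fits w)

/-- The value of an entry expression. -/
def EExp.eval {α : Type*} (w : ℕ) (s : State α) : EExp → Option (WithTop α)
  | .top => some ⊤
  | .cell A e => (e.eval w s).map fun i => s.ent A i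

/-- The truth value of a test. -/
def Test.eval {α : Type*} [LinearOrder α] (w : ℕ) (s : State α) : Test → Option Bool
  | .lt e₁ e₂ => (e₁.eval w s).bind fun x => (e₂.eval w s).map fun y => decide (x < y)
  | .eq e₁ e₂ => (e₁.eval w s).bind fun x => (e₂.eval w s).map fun y => decide (x = y)
  | .entLt u₁ u₂ => (u₁.eval w s).bind fun x => (u₂.eval w s).map fun y => decide (x < y)
  | .not b => (b.eval w s).map fun x => !x
  | .and b₁ b₂ => (b₁.eval w s).bind fun x => (b₂.eval w s).map fun y => x && y

/-- The number of steps for evaluating an expression: one for each constant, each access to a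
register or cell, and each operation. -/
def WExp.cost : WExp → ℕ
  | .const _ => 1
  | .reg _ => 1
  | .cell _ e => e.cost + 1
  | .op _ e₁ e₂ => e₁.cost + e₂.cost + 1

/-- The number of steps for evaluating an entry expression. -/
def EExp.cost : EExp → ℕ
  | .top => 1
  | .cell _ e => e.cost + 1

/-- The number of steps for evaluating a test. -/
def Test.cost : Test → ℕ
  | .lt e₁ e₂ => e₁.cost + e₂.cost + 1
  | .eq e₁ e₂ => e₁.cost + e₂.cost + 1
  | .entLt u₁ u₂ => u₁.cost + u₂.cost + 1
  | .not b => b.cost + 1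
  | .and b₁ b₂ => b₁.cost + b₂.cost + 1

/-- Write to a word register. -/
def State.writeReg {α : Type*} (s : State α) (x v : ℕ) : State α :=
  { s with reg := Function.update s.reg x v }

/-- Write to a cell of a word array. -/
def State.writeArr {α : Type*} (s : State α) (A i v : ℕ) : State α :=
  { s with arr := Function.update s.arr A (Function.update (s.arr A) i v) }

/-- Write to a cell of an entry array. -/
def State.writeEnt {α : Type*} (s : State α) (A i : ℕ) (v : WithTop α) : State α :=
  { s with ent := Function.update s.ent A (Function.update (s.ent A) i v) }

/-- `Exec w p s t s'`: on `w`-bit words, program `p` started in memory state `s` halts without error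
after exactly `t` steps, in memory state `s'`. -/
inductive Exec {α : Type*} [LinearOrder α] (w : ℕ) : Prog → State α → ℕ → State α → Prop where
  | skip (s : State α) : Exec w .skip s 1 s
  | setReg {s : State α} {x : ℕ} {e : WExp} {v : ℕ} (he : e.eval w s = some v) :
      Exec w (.setReg x e) s (e.cost + 1) (s.writeReg x v)
  | setArr {s : State α} {A : ℕ} {e₁ e₂ : WExp} {i v : ℕ}
      (h₁ : e₁.eval w s = some i) (h₂ : e₂.eval w s = some v) :
      Exec w (.setArr A e₁ e₂) s (e₁.cost + e₂.cost + 1) (s.writeArr A i v)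
  | setEnt {s : State α} {A : ℕ} {e : WExp} {u : EExp} {i : ℕ} {v : WithTop α}
      (he : e.eval w s = some i) (hu : u.eval w s = some v) :
      Exec w (.setEnt A e u) s (e.cost + u.cost + 1) (s.writeEnt A i v)
  | seq {p q : Prog} {s s₁ s₂ : State α} {t₁ t₂ : ℕ}
      (hp : Exec w p s t₁ s₁) (hq : Exec w q s₁ t₂ s₂) :
      Exec w (.seq p q) s (t₁ + t₂) s₂
  | iteTrue {b : Test} {p q : Prog} {s s₁ : State α} {t : ℕ}
      (hb : b.eval w s = some true) (hp : Exec w p s t s₁) :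
      Exec w (.ite b p q) s (b.cost + 1 + t) s₁
  | iteFalse {b : Test} {p q : Prog} {s s₁ : State α} {t : ℕ}
      (hb : b.eval w s = some false) (hq : Exec w q s t s₁) :
      Exec w (.ite b p q) s (b.cost + 1 + t) s₁
  | whileFalse {b : Test} {p : Prog} {s : State α} (hb : b.eval w s = some false) :
      Exec w (.while b p) s (b.cost + 1) s
  | whileTrue {b : Test} {p : Prog} {s s₁ s₂ : State α} {t₁ t₂ : ℕ}
      (hb : b.eval w s = some true) (hp : Exec w p s t₁ s₁) (hr : Exec w (.while b p) s₁ t₂ s₂) :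
      Exec w (.while b p) s (b.cost + 1 + t₁ + t₂) s₂

/-! ### Input and output -/

/-- All intervals of a representation, column after column. -/
def allIntervals {α : Type*} {m : ℕ} (R : Fin m → List (ColInterval α)) : List (ColInterval α) :=
  (List.ofFn R).flatten

/-- The number of intervals in the first `j` columns. -/
def offset {α : Type*} {m : ℕ} (R : Fin m → List (ColInterval α)) (j : ℕ) : ℕ :=
  ((List.ofFn R).take j).flatten.length

/-- The input for an `n × m` matrix represented by `R`.  Registers `0` and `1` hold `n` and `m`.
All intervals are stored column after column: their first rows in word array `1`, their last rows
in word array `2`, their values in entry array `0`; the intervals of the `j`-th column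
(`j = 0, …, m - 1`) occupy the positions `p` with `offset j ≤ p < offset (j + 1)`, and word array
`0` holds `offset 0, …, offset m`.  All other words are `0`, all other entries are `∞`. -/
def input {α : Type*} (n : ℕ) {m : ℕ} (R : Fin m → List (ColInterval α)) : State α where
  reg x := if x = 0 then n else if x = 1 then m else 0
  arr A p :=
    if A = 0 then (if p ≤ m then offset R p else 0)
    else if A = 1 then ((allIntervals R)[p]?.map ColInterval.first).getD 0
    else if A = 2 then ((allIntervals R)[p]?.map ColInterval.last).getD 0
    else 0
  ent A p :=
    if A = 0 then ((allIntervals R)[p]?.map fun I => (I.value : WithTop α)).getD ⊤ else ⊤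

end RowMinima

/-!
The program distributes the intervals over several data structures and then sweeps over the rows.

The rows are divided into blocks of `B = ⌊log₂ (n + 2)⌋` consecutive rows.  An interval that meets
at least two blocks is cut into a final part of its first block, an initial part of its last block,
and the run of entire blocks in between.  The first two kinds of parts are recorded at their first
and last row, respectively, and are resolved by running minima within the blocks (`suffixMinima`,
`prefixMinima`).  A run of entire blocks is the union of two runs of `2 ^ l` blocks, for some `l`,
which may overlap because minima are idempotent; it is recorded in two cells of a sparse table with
one row for each `l`.  The table has `O(n / B * log n) = O(n)` cells, and `pushDown` passes the
content of each cell to the two cells for its halves, so that finally the bottom row holds one value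
for each block (this is the usual sparse table for range minimum queries, run backwards).

An interval within one block is inserted when the sweep arrives at its first row.  For each block
the sweep maintains the function that maps a row `y` to the least value of an inserted interval of
that block with last row at or after `y`.  This function is a staircase; its steps are stored as a
bit mask of `B` bits in one word, and precomputed tables of size `O(2 ^ B) = O(n)` for the
logarithm and for the lowest set bit provide the next step at or after a row and the last step at or
before it in constant time (`Stair.succ`, `Stair.pred`).  To insert an interval, the steps that
become superfluous are removed, starting with the last one; since each interval adds at most one
step, the total number of removals is at most the number of intervals.  At row `r`, all inserted
intervals of the block start at or before `r`, so the staircase at `r` is the minimum over the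
intervals that contain `r`.

With at most `k` intervals per column there are `N ≤ k * m` intervals, and the program takes
`O(n + N)` steps.  Minima are specified throughout by their lower bounds (`z ≤ … ↔ ∀ …, z ≤ …`),
so no infima over index sets are needed.

Running times are verified by passing on a budget of steps: `Wp w p Q s T` says that `p` runs
without error within the budget `T` and that `Q` holds for the final state and the rest of the
budget.  As the invariants of loops may depend on the budget, it carries the amortized analysis (the
potential of a staircase is its number of steps) and also proves termination.

Memory: registers `0`, `2`, `3`, `4` hold `n`, `N`, `B` and the number of blocks.  Word arrays `1`
and `2` hold the first and last rows of the intervals, `3`, `4` and `5` the tables of logarithms,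
lowest set bits and powers of two, `6` and `7` the heads and the links of the lists of intervals
within one block, `8` the bit masks.  Entry array `0` holds the values of the intervals, `1` the
output, `2` the sparse table, `3` and `4` the minima for final and initial parts of blocks, `5` the
values of the steps of the staircases.
-/

namespace RowMinima

/-! ### Weakest preconditions with a time budget -/

section Framework

variable {α : Type*}

@[simp] theorem State.writeReg_reg (s : State α) (x v y : ℕ) :
    (s.writeReg x v).reg y = if y = x then v else s.reg y := by
  simp [State.writeReg, Function.update_apply]

@[simp] theorem State.writeReg_arr (s : State α) (x v : ℕ) : (s.writeReg x v).arr = s.arr := rfl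

@[simp] theorem State.writeReg_ent (s : State α) (x v : ℕ) : (s.writeReg x v).ent = s.ent := rfl

@[simp] theorem State.writeArr_reg (s : State α) (A i v : ℕ) : (s.writeArr A i v).reg = s.reg := rfl

@[simp] theorem State.writeArr_arr (s : State α) (A i v A' : ℕ) :
    (s.writeArr A i v).arr A' = if A' = A then Function.update (s.arr A) i v else s.arr A' := by
  simp [State.writeArr, Function.update_apply]

@[simp] theorem State.writeArr_ent (s : State α) (A i v : ℕ) : (s.writeArr A i v).ent = s.ent := rfl

@[simp] theorem State.writeEnt_reg (s : State α) (A i : ℕ) (v : WithTop α) :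
    (s.writeEnt A i v).reg = s.reg := rfl

@[simp] theorem State.writeEnt_arr (s : State α) (A i : ℕ) (v : WithTop α) :
    (s.writeEnt A i v).arr = s.arr := rfl

@[simp] theorem State.writeEnt_ent (s : State α) (A i : ℕ) (v : WithTop α) (A' : ℕ) :
    (s.writeEnt A i v).ent A' = if A' = A then Function.update (s.ent A) i v else s.ent A' := by
  simp [State.writeEnt, Function.update_apply]

/-- The value of a word expression when no word overflows. -/
def WExp.val (s : State α) : WExp → ℕ
  | .const v => v
  | .reg x => s.reg x
  | .cell A e => s.arr A (e.val s)
  | .op .add e₁ e₂ => e₁.val s + e₂.val s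
  | .op .sub e₁ e₂ => e₁.val s - e₂.val s
  | .op .mul e₁ e₂ => e₁.val s * e₂.val s
  | .op .div e₁ e₂ => e₁.val s / e₂.val s

/-- The evaluation of a word expression meets neither an overflow nor a division by zero.
Differences and quotients do not exceed their first operand, so they need no condition. -/
def WExp.Ok (w : ℕ) (s : State α) : WExp → Prop
  | .const v => v < 2 ^ w
  | .reg x => s.reg x < 2 ^ w
  | .cell A e => e.Ok w s ∧ s.arr A (e.val s) < 2 ^ w
  | .op .add e₁ e₂ => e₁.Ok w s ∧ e₂.Ok w s ∧ e₁.val s + e₂.val s < 2 ^ w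
  | .op .sub e₁ e₂ => e₁.Ok w s ∧ e₂.Ok w s
  | .op .mul e₁ e₂ => e₁.Ok w s ∧ e₂.Ok w s ∧ e₁.val s * e₂.val s < 2 ^ w
  | .op .div e₁ e₂ => e₁.Ok w s ∧ e₂.Ok w s ∧ e₂.val s ≠ 0

theorem WExp.Ok.lt {w : ℕ} {s : State α} : ∀ {e : WExp}, e.Ok w s → e.val s < 2 ^ w
  | .const _, h => h
  | .reg _, h => h
  | .cell _ _, h => h.2
  | .op .add _ _, h => h.2.2
  | .op .sub _ _, h => lt_of_le_of_lt (Nat.sub_le _ _) (WExp.Ok.lt h.1)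
  | .op .mul _ _, h => h.2.2
  | .op .div _ _, h => lt_of_le_of_lt (Nat.div_le_self _ _) (WExp.Ok.lt h.1)

theorem WExp.eval_eq {w : ℕ} {s : State α} : ∀ {e : WExp}, e.Ok w s → e.eval w s = some (e.val s)
  | .const _, h => if_pos h
  | .reg _, h => if_pos h
  | .cell A e, h => by
      simpa [WExp.eval, WExp.eval_eq h.1, fits, WExp.val] using h.2
  | .op o e₁ e₂, h => by
      have hlt := h.lt
      have h12 : e₁.Ok w s ∧ e₂.Ok w s := by
        cases o <;> exact ⟨h.1, by first | exact h.2.1 | exact h.2⟩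
      cases o <;> simp [WExp.eval, WExp.eval_eq h12.1, WExp.eval_eq h12.2, fits, WExp.val,
        Op.apply] at hlt ⊢
      · exact hlt
      · exact hlt
      · exact hlt
      · rw [if_neg h.2.2]
        simpa [fits] using hlt

/-- The value of an entry expression when no word overflows. -/
def EExp.val (s : State α) : EExp → WithTop α
  | .top => ⊤
  | .cell A e => s.ent A (e.val s)

/-- The address in an entry expression is evaluated without error. -/
def EExp.Ok (w : ℕ) (s : State α) : EExp → Prop
  | .top => True
  | .cell _ e => e.Ok w s

theorem EExp.eval_eq {w : ℕ} {s : State α} : ∀ {u : EExp}, u.Ok w s → u.eval w s = some (u.val s)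
  | .top, _ => rfl
  | .cell A e, h => by simp [EExp.eval, WExp.eval_eq (e := e) h, EExp.val]

/-- The registers written by a program. -/
def Prog.regs : Prog → List ℕ
  | .setReg x _ => [x]
  | .seq p q => p.regs ++ q.regs
  | .ite _ p q => p.regs ++ q.regs
  | .while _ p => p.regs
  | _ => []

/-- The word arrays written by a program. -/
def Prog.arrs : Prog → List ℕ
  | .setArr A _ _ => [A]
  | .seq p q => p.arrs ++ q.arrs
  | .ite _ p q => p.arrs ++ q.arrs
  | .while _ p => p.arrs
  | _ => []

/-- The entry arrays written by a program. -/
def Prog.ents : Prog → List ℕ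
  | .setEnt A _ _ => [A]
  | .seq p q => p.ents ++ q.ents
  | .ite _ p q => p.ents ++ q.ents
  | .while _ p => p.ents
  | _ => []

/-- `s` and `s'` differ only in registers and arrays that `p` writes. -/
structure Frame (p : Prog) (s s' : State α) : Prop where
  reg : ∀ x, x ∉ p.regs → s'.reg x = s.reg x
  arr : ∀ A, A ∉ p.arrs → s'.arr A = s.arr A
  ent : ∀ A, A ∉ p.ents → s'.ent A = s.ent A

theorem Frame.refl (p : Prog) (s : State α) : Frame p s s :=
  ⟨fun _ _ => rfl, fun _ _ => rfl, fun _ _ => rfl⟩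

theorem Frame.trans {p : Prog} {s₁ s₂ s₃ : State α} (h : Frame p s₁ s₂) (h' : Frame p s₂ s₃) :
    Frame p s₁ s₃ :=
  ⟨fun x hx => (h'.reg x hx).trans (h.reg x hx), fun x hx => (h'.arr x hx).trans (h.arr x hx),
    fun x hx => (h'.ent x hx).trans (h.ent x hx)⟩

theorem Frame.weaken {p q : Prog} {s s' : State α} (h : Frame p s s') (h₁ : p.regs ⊆ q.regs)
    (h₂ : p.arrs ⊆ q.arrs) (h₃ : p.ents ⊆ q.ents) : Frame q s s' :=
  ⟨fun x hx => h.reg x fun hh => hx (h₁ hh), fun x hx => h.arr x fun hh => hx (h₂ hh),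
    fun x hx => h.ent x fun hh => hx (h₃ hh)⟩

variable [LinearOrder α]

/-- The truth value of a test when no word overflows. -/
def Test.val (s : State α) : Test → Prop
  | .lt e₁ e₂ => e₁.val s < e₂.val s
  | .eq e₁ e₂ => e₁.val s = e₂.val s
  | .entLt u₁ u₂ => u₁.val s < u₂.val s
  | .not b => ¬ b.val s
  | .and b₁ b₂ => b₁.val s ∧ b₂.val s

/-- A test is evaluated without error. -/
def Test.Ok (w : ℕ) (s : State α) : Test → Prop
  | .lt e₁ e₂ => e₁.Ok w s ∧ e₂.Ok w s
  | .eq e₁ e₂ => e₁.Ok w s ∧ e₂.Ok w s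
  | .entLt u₁ u₂ => u₁.Ok w s ∧ u₂.Ok w s
  | .not b => b.Ok w s
  | .and b₁ b₂ => b₁.Ok w s ∧ b₂.Ok w s

theorem Test.eval_eq {w : ℕ} {s : State α} : ∀ {b : Test}, b.Ok w s →
    ∃ r, b.eval w s = some r ∧ (r = true ↔ b.val s)
  | .lt e₁ e₂, h => ⟨decide (e₁.val s < e₂.val s),
      by simp [Test.eval, WExp.eval_eq h.1, WExp.eval_eq h.2], by simp [Test.val]⟩
  | .eq e₁ e₂, h => ⟨decide (e₁.val s = e₂.val s),
      by simp [Test.eval, WExp.eval_eq h.1, WExp.eval_eq h.2], by simp [Test.val]⟩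
  | .entLt e₁ e₂, h => ⟨decide (e₁.val s < e₂.val s),
      by simp [Test.eval, EExp.eval_eq h.1, EExp.eval_eq h.2], by simp [Test.val]⟩
  | .not b, h => by
      obtain ⟨r, h1, h2⟩ := Test.eval_eq (b := b) h
      exact ⟨!r, by simp [Test.eval, h1], by simp [Test.val, ← h2]⟩
  | .and b₁ b₂, h => by
      obtain ⟨r, h1, h2⟩ := Test.eval_eq h.1
      obtain ⟨r', h1', h2'⟩ := Test.eval_eq h.2
      exact ⟨r && r', by simp [Test.eval, h1, h1'], by simp [Test.val, ← h2, ← h2']⟩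

theorem Test.eval_of_val {w : ℕ} {s : State α} {b : Test} (h : b.Ok w s) (hv : b.val s) :
    b.eval w s = some true := by
  obtain ⟨r, h1, h2⟩ := Test.eval_eq h
  rw [h1, h2.2 hv]

theorem Test.eval_of_not_val {w : ℕ} {s : State α} {b : Test} (h : b.Ok w s) (hv : ¬ b.val s) :
    b.eval w s = some false := by
  obtain ⟨r, h1, h2⟩ := Test.eval_eq h
  rw [h1, Bool.eq_false_iff.2 (fun hr => hv (h2.1 hr))]

/-- Started in state `s` with a budget of `T` steps, program `p` halts without error within the
budget, and `Q` holds for the final state and (a lower bound on) the remaining budget. -/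
def Wp (w : ℕ) (p : Prog) (Q : State α → ℕ → Prop) (s : State α) (T : ℕ) : Prop :=
  ∃ t s' T', Exec w p s t s' ∧ t + T' ≤ T ∧ Q s' T'

theorem Wp.mono {w : ℕ} {p : Prog} {Q Q' : State α → ℕ → Prop} {s : State α} {T : ℕ}
    (h : Wp w p Q s T) (hQ : ∀ s' T', Q s' T' → Q' s' T') : Wp w p Q' s T := by
  obtain ⟨t, s', T', h1, h2, h3⟩ := h
  exact ⟨t, s', T', h1, h2, hQ _ _ h3⟩

theorem Wp.seq {w : ℕ} {p q : Prog} {Q : State α → ℕ → Prop} {s : State α} {T : ℕ}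
    (h : Wp w p (Wp w q Q) s T) : Wp w (.seq p q) Q s T := by
  obtain ⟨t, s', T', h1, h2, t2, s2, T2, h3, h4, h5⟩ := h
  exact ⟨t + t2, s2, T2, .seq h1 h3, by omega, h5⟩

theorem Wp.ite {w : ℕ} {b : Test} {p q : Prog} {Q : State α → ℕ → Prop} {s : State α} {T : ℕ}
    (hb : b.Ok w s) (hT : b.cost + 1 ≤ T)
    (hp : b.val s → Wp w p Q s (T - (b.cost + 1)))
    (hq : ¬ b.val s → Wp w q Q s (T - (b.cost + 1))) : Wp w (.ite b p q) Q s T := by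
  by_cases h : b.val s
  · obtain ⟨t, s', T', h1, h2, h3⟩ := hp h
    exact ⟨_, s', T', .iteTrue (Test.eval_of_val hb h) h1, by omega, h3⟩
  · obtain ⟨t, s', T', h1, h2, h3⟩ := hq h
    exact ⟨_, s', T', .iteFalse (Test.eval_of_not_val hb h) h1, by omega, h3⟩

/-- An upper bound on the running time of a program without loops. -/
def Prog.maxCost : Prog → ℕ
  | .skip => 1
  | .setReg _ e => e.cost + 1
  | .setArr _ e₁ e₂ => e₁.cost + e₂.cost + 1
  | .setEnt _ e u => e.cost + u.cost + 1
  | .seq p q => p.maxCost + q.maxCost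
  | .ite b p q => b.cost + 1 + max p.maxCost q.maxCost
  | .while _ _ => 0

/-- The weakest precondition of a program without loops; time is accounted for separately, by
`Prog.maxCost`. -/
def vc (w : ℕ) : Prog → (State α → Prop) → State α → Prop
  | .skip, Q, s => Q s
  | .setReg x e, Q, s => e.Ok w s ∧ Q (s.writeReg x (e.val s))
  | .setArr A e₁ e₂, Q, s => e₁.Ok w s ∧ e₂.Ok w s ∧ Q (s.writeArr A (e₁.val s) (e₂.val s))
  | .setEnt A e u, Q, s => e.Ok w s ∧ u.Ok w s ∧ Q (s.writeEnt A (e.val s) (u.val s))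
  | .seq p q, Q, s => vc w p (vc w q Q) s
  | .ite b p q, Q, s => b.Ok w s ∧ (b.val s → vc w p Q s) ∧ (¬ b.val s → vc w q Q s)
  | .while _ _, _, _ => False

theorem vc_sound {w : ℕ} : ∀ {p : Prog} {Q : State α → Prop} {s : State α}, vc w p Q s →
    ∃ t s', Exec w p s t s' ∧ t ≤ p.maxCost ∧ Q s'
  | .skip, _, s, h => ⟨_, _, .skip s, le_rfl, h⟩
  | .setReg _ _, _, _, h => ⟨_, _, .setReg (WExp.eval_eq h.1), le_rfl, h.2⟩
  | .setArr _ _ _, _, _, h =>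
      ⟨_, _, .setArr (WExp.eval_eq h.1) (WExp.eval_eq h.2.1), le_rfl, h.2.2⟩
  | .setEnt _ _ _, _, _, h =>
      ⟨_, _, .setEnt (WExp.eval_eq h.1) (EExp.eval_eq h.2.1), le_rfl, h.2.2⟩
  | .seq p q, _, _, h => by
      obtain ⟨t, s', h1, h2, h3⟩ := vc_sound (p := p) h
      obtain ⟨t', s'', h4, h5, h6⟩ := vc_sound (p := q) h3
      exact ⟨_, _, .seq h1 h4, Nat.add_le_add h2 h5, h6⟩
  | .ite b p q, _, s, h => by
      by_cases hb : b.val s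
      · obtain ⟨t, s', h1, h2, h3⟩ := vc_sound (h.2.1 hb)
        exact ⟨_, _, .iteTrue (Test.eval_of_val h.1 hb) h1, by simp only [Prog.maxCost]; omega, h3⟩
      · obtain ⟨t, s', h1, h2, h3⟩ := vc_sound (h.2.2 hb)
        exact ⟨_, _, .iteFalse (Test.eval_of_not_val h.1 hb) h1, by simp only [Prog.maxCost]; omega, h3⟩

theorem Wp.of_vc {w : ℕ} {p : Prog} {Q : State α → ℕ → Prop} {s : State α} {T : ℕ}
    (hT : p.maxCost ≤ T) (h : vc w p (fun s' => Q s' (T - p.maxCost)) s) : Wp w p Q s T := by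
  obtain ⟨t, s', h1, h2, h3⟩ := vc_sound h
  exact ⟨t, s', _, h1, by omega, h3⟩

theorem Exec.frame {w : ℕ} {p : Prog} {s s' : State α} {t : ℕ} (h : Exec w p s t s') :
    Frame p s s' := by
  induction h with
  | skip s => exact .refl _ s
  | setReg he => exact ⟨fun x hx => by simp_all [Prog.regs], fun _ _ => rfl, fun _ _ => rfl⟩
  | setArr h₁ h₂ =>
    exact ⟨fun _ _ => rfl, fun x hx => by simp_all [Prog.arrs], fun _ _ => rfl⟩
  | setEnt h₁ h₂ =>
    exact ⟨fun _ _ => rfl, fun _ _ => rfl, fun x hx => by simp_all [Prog.ents]⟩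
  | seq hp hq ih1 ih2 =>
    exact (ih1.weaken (by simp [Prog.regs]) (by simp [Prog.arrs]) (by simp [Prog.ents])).trans
      (ih2.weaken (by simp [Prog.regs]) (by simp [Prog.arrs]) (by simp [Prog.ents]))
  | iteTrue hb hp ih =>
    exact ih.weaken (by simp [Prog.regs]) (by simp [Prog.arrs]) (by simp [Prog.ents])
  | iteFalse hb hp ih =>
    exact ih.weaken (by simp [Prog.regs]) (by simp [Prog.arrs]) (by simp [Prog.ents])
  | whileFalse hb => exact .refl _ _
  | whileTrue hb hp hr ih1 ih2 =>
    exact (ih1.weaken (by simp [Prog.regs]) (by simp [Prog.arrs]) (by simp [Prog.ents])).trans ih2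

theorem Wp.frame {w : ℕ} {p : Prog} {Q : State α → ℕ → Prop} {s : State α} {T : ℕ}
    (h : Wp w p Q s T) : Wp w p (fun s' T' => Frame p s s' ∧ Q s' T') s T := by
  obtain ⟨t, s', T', h1, h2, h3⟩ := h
  exact ⟨t, s', T', h1, h2, h1.frame, h3⟩

/-- Sequential composition; the second program may rely on everything that the first one does not
write. -/
theorem Wp.seq_frame {w : ℕ} {p q : Prog} {Q Q' : State α → ℕ → Prop} {s : State α} {T : ℕ}
    (hp : Wp w p Q' s T) (hq : ∀ s' T', Frame p s s' → Q' s' T' → Wp w q Q s' T') :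
    Wp w (.seq p q) Q s T :=
  .seq (hp.frame.mono fun s' T' h => hq s' T' h.1 h.2)

/-- The loop rule.  The invariant `I` may depend on the remaining budget, which every
iteration diminishes; hence no separate termination argument is needed. -/
theorem Wp.loop {w : ℕ} {b : Test} {p : Prog} {Q : State α → ℕ → Prop} {s : State α} {T : ℕ}
    (I : State α → ℕ → Prop) (h0 : I s T)
    (hstep : ∀ s' T', Frame p s s' → I s' T' → b.Ok w s' ∧ b.cost + 1 ≤ T' ∧
      (b.val s' → Wp w p I s' (T' - (b.cost + 1))) ∧ (¬ b.val s' → Q s' (T' - (b.cost + 1)))) :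
    Wp w (.while b p) Q s T := by
  suffices H : ∀ N s' T', T' ≤ N → Frame p s s' → I s' T' → Wp w (.while b p) Q s' T' from
    H T s T le_rfl (.refl _ _) h0
  intro N
  induction N with
  | zero =>
    intro s' T' hT hF hI
    obtain ⟨-, h, -⟩ := hstep s' T' hF hI
    omega
  | succ N ih =>
    intro s' T' hT hF hI
    obtain ⟨hb, hc, h1, h2⟩ := hstep s' T' hF hI
    by_cases hv : b.val s'
    · obtain ⟨t, s1, T1, e1, l1, i1⟩ := h1 hv
      obtain ⟨t2, s2, T2, e2, l2, i2⟩ := ih s1 T1 (by omega) (hF.trans e1.frame) i1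
      exact ⟨_, s2, T2, .whileTrue (Test.eval_of_val hb hv) e1 e2, by omega, i2⟩
    · exact ⟨_, s', _, .whileFalse (Test.eval_of_not_val hb hv), by omega, h2 hv⟩

/-- `minInto A i A' j` replaces cell `i` of entry array `A` by its minimum with cell `j` of `A'`. -/
def minInto (A : ℕ) (i : WExp) (A' : ℕ) (j : WExp) : Prog :=
  .ite (.entLt (.cell A' j) (.cell A i)) (.setEnt A i (.cell A' j)) .skip

theorem vc_minInto {w A A' : ℕ} {i j : WExp} {Q : State α → Prop} {s : State α} :
    vc w (minInto A i A' j) Q s ↔ i.Ok w s ∧ j.Ok w s ∧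
      Q (s.writeEnt A (i.val s) (min (s.ent A (i.val s)) (s.ent A' (j.val s)))) := by
  have h1 : s.writeEnt A (i.val s) (s.ent A (i.val s)) = s := by simp [State.writeEnt]
  simp only [minInto, vc, Test.Ok, EExp.Ok, Test.val, EExp.val]
  by_cases h : s.ent A' (j.val s) < s.ent A (i.val s)
  · simp only [h, min_eq_right h.le]
    tauto
  · simp only [h, min_eq_left (not_lt.1 h), h1]
    tauto

/-- The lower bounds of a function after one of its values has been replaced by a minimum. -/
theorem le_update_min_iff {f : ℕ → WithTop α} {x : ℕ} {v : WithTop α} {y : ℕ} {z : WithTop α} :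
    z ≤ Function.update f x (min (f x) v) y ↔ z ≤ f y ∧ (y = x → z ≤ v) := by
  by_cases h : y = x
  · subst h; simp
  · simp [h]

end Framework

/-! ### Sets of small numbers as bit masks -/

section Bits

theorem testBit_sub_two_pow {k i : ℕ} (h : k.testBit i = true) (j : ℕ) :
    (k - 2 ^ i).testBit j = (k.testBit j && decide (j ≠ i)) := by
  induction i generalizing k j with
  | zero =>
    rw [Nat.testBit_zero, decide_eq_true_eq] at h
    cases j with
    | zero => simp; omega
    | succ j =>
      rw [Nat.testBit_succ, Nat.testBit_succ, show (k - 2 ^ 0) / 2 = k / 2 by omega]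
      simp
  | succ i ih =>
    have hle := Nat.ge_two_pow_of_testBit h
    rw [Nat.testBit_succ] at h
    cases j with
    | zero => simp [pow_succ] at hle ⊢; omega
    | succ j =>
      rw [Nat.testBit_succ, Nat.testBit_succ, show (k - 2 ^ (i + 1)) / 2 = k / 2 - 2 ^ i by
        rw [pow_succ]; omega, ih h]
      simp

theorem testBit_add_two_pow {k i : ℕ} (h : k.testBit i = false) (j : ℕ) :
    (k + 2 ^ i).testBit j = (k.testBit j || decide (j = i)) := by
  have h1 : (k + 2 ^ i).testBit i = true := by
    rw [Nat.add_comm, Nat.testBit_two_pow_add_eq, h]; rfl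
  have h2 := testBit_sub_two_pow h1 j
  rw [Nat.add_sub_cancel] at h2
  by_cases hj : j = i
  · subst hj; simp [h1]
  · simpa [hj] using h2.symm

/-- The position of the lowest bit that is set (and `0` for the number `0`). -/
def lowBit (d : ℕ) : ℕ :=
  if d = 0 ∨ d % 2 = 1 then 0 else lowBit (d / 2) + 1
termination_by d
decreasing_by omega

theorem lowBit_of_odd {d : ℕ} (h : d = 0 ∨ d % 2 = 1) : lowBit d = 0 := by
  rw [lowBit, if_pos h]

theorem lowBit_of_even {d : ℕ} (h0 : d ≠ 0) (h : d % 2 ≠ 1) : lowBit d = lowBit (d / 2) + 1 := by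
  rw [lowBit, if_neg (by tauto)]

theorem testBit_lowBit {d : ℕ} (h : d ≠ 0) : d.testBit (lowBit d) = true := by
  induction d using Nat.strong_induction_on with
  | _ d ih =>
    by_cases hd : d % 2 = 1
    · rw [lowBit_of_odd (.inr hd)]; simpa using hd
    · rw [lowBit_of_even h hd, Nat.testBit_succ]
      exact ih _ (by omega) (by omega)

theorem lowBit_le_of_testBit {d i : ℕ} (h : d.testBit i = true) : lowBit d ≤ i := by
  induction i generalizing d with
  | zero => simp at h; rw [lowBit_of_odd (.inr h)]
  | succ i ih =>
    by_cases hd : d = 0 ∨ d % 2 = 1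
    · rw [lowBit_of_odd hd]; omega
    · rw [lowBit_of_even (by tauto) (by tauto)]
      exact Nat.succ_le_succ (ih (by rwa [← Nat.testBit_succ]))

theorem lowBit_le (d : ℕ) : lowBit d ≤ Nat.log 2 d := by
  by_cases h : d = 0
  · simp [h, lowBit_of_odd]
  · refine lowBit_le_of_testBit ?_
    rw [← Nat.log2_eq_log_two]
    exact Nat.testBit_log2 h

/-- The lowest set bit at or above a given position. -/
theorem lowBit_div_spec {k j : ℕ} (h : k / 2 ^ j ≠ 0) :
    k.testBit (j + lowBit (k / 2 ^ j)) = true ∧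
      ∀ i, j ≤ i → k.testBit i = true → j + lowBit (k / 2 ^ j) ≤ i := by
  constructor
  · have := testBit_lowBit h
    rwa [Nat.testBit_div_two_pow, Nat.add_comm] at this
  · intro i hi hk
    have : (k / 2 ^ j).testBit (i - j) = true := by
      rwa [Nat.testBit_div_two_pow, Nat.sub_add_cancel hi]
    have := lowBit_le_of_testBit this
    omega

theorem div_two_pow_eq_zero {k j i : ℕ} (h : k / 2 ^ j = 0) (hi : j ≤ i) : k.testBit i = false := by
  have : k < 2 ^ j := by simpa using h
  exact Nat.testBit_lt_two_pow (this.trans_le (Nat.pow_le_pow_right (by norm_num) hi))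

/-- The highest set bit at or below a given position. -/
theorem log_mod_spec {k j : ℕ} (h : k % 2 ^ (j + 1) ≠ 0) :
    Nat.log 2 (k % 2 ^ (j + 1)) ≤ j ∧ k.testBit (Nat.log 2 (k % 2 ^ (j + 1))) = true ∧
      ∀ i, i ≤ j → k.testBit i = true → i ≤ Nat.log 2 (k % 2 ^ (j + 1)) := by
  have h1 := Nat.testBit_log2 h
  rw [Nat.log2_eq_log_two, Nat.testBit_mod_two_pow] at h1
  simp only [Bool.and_eq_true, decide_eq_true_eq] at h1
  refine ⟨by omega, h1.2, fun i hi hk => ?_⟩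
  refine Nat.le_log_of_pow_le (by norm_num) (Nat.ge_two_pow_of_testBit ?_)
  rw [Nat.testBit_mod_two_pow, hk]
  simpa using Nat.lt_succ_of_le hi

theorem mod_two_pow_eq_zero {k j i : ℕ} (h : k % 2 ^ (j + 1) = 0) (hi : i ≤ j) :
    k.testBit i = false := by
  have h1 : (k % 2 ^ (j + 1)).testBit i = false := by simp [h]
  rw [Nat.testBit_mod_two_pow] at h1
  simpa [Nat.lt_succ_of_le hi] using h1

end Bits

/-! ### Tables of logarithms, lowest set bits and powers of two -/

section

attribute [simp] vc Prog.maxCost WExp.cost EExp.cost Test.cost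
attribute [simp] WExp.Ok WExp.val Test.Ok Test.val EExp.Ok EExp.val vc_minInto

/-! The superscript marks operations on word expressions. -/

infixl:65 " +ʷ " => WExp.op Op.add
infixl:65 " -ʷ " => WExp.op Op.sub
infixl:70 " *ʷ " => WExp.op Op.mul
infixl:70 " /ʷ " => WExp.op Op.div
infixr:40 " ;; " => Prog.seq

/-- Compute the tables at `x` (register `5`) from their values at `x / 2`; the power `2 ^ log x` is
rewritten for every `x` with the same logarithm. -/
def tablesStep : Prog :=
  .setReg 6 (.cell 3 (.reg 5 /ʷ .const 2)) ;;
  .setArr 3 (.reg 5) (.reg 6 +ʷ .const 1) ;;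
  .ite (.eq (.reg 5 /ʷ .const 2 *ʷ .const 2) (.reg 5))
    (.setArr 4 (.reg 5) (.cell 4 (.reg 5 /ʷ .const 2) +ʷ .const 1))
    (.setArr 4 (.reg 5) (.const 0)) ;;
  .setArr 5 (.reg 6 +ʷ .const 1) (.cell 5 (.reg 6) *ʷ .const 2) ;;
  .setReg 5 (.reg 5 +ʷ .const 1)

/-- Compute the tables for `x ≤ n + 2`, and the number of intervals, the size of the blocks and the
number of blocks. -/
def tables : Prog :=
  (.setArr 5 (.const 0) (.const 1) ;; .setReg 5 (.const 2)) ;;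
  .while (.lt (.reg 5) (.reg 0 +ʷ .const 3)) tablesStep ;;
  .setReg 2 (.cell 0 (.reg 1)) ;;
  .setReg 3 (.cell 3 (.reg 0 +ʷ .const 2)) ;;
  .setReg 4 (.reg 0 /ʷ .reg 3 +ʷ .const 1)

variable {α : Type*}

/-- The three tables are correct. -/
structure Tables (n : ℕ) (s : State α) : Prop where
  log : ∀ y ≤ n + 2, s.arr 3 y = Nat.log 2 y
  low : ∀ y ≤ n + 2, s.arr 4 y = lowBit y
  pow : ∀ j ≤ Nat.log 2 (n + 2), s.arr 5 j = 2 ^ j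

variable [LinearOrder α]

theorem tables_spec {w n N T₀ T : ℕ} {s : State α} (hw : N + 4 * (n + 3) ^ 2 < 2 ^ w)
    (hn : s.reg 0 = n) (hm : s.reg 1 < 2 ^ w) (hN : s.arr 0 (s.reg 1) = N)
    (h3 : ∀ y, s.arr 3 y = 0) (h4 : ∀ y, s.arr 4 y = 0)
    (hT : T₀ + 100 * (n + 3) ≤ T) :
    Wp w tables (fun s' T' => (Tables n s' ∧ s'.reg 2 = N ∧ s'.reg 3 = Nat.log 2 (n + 2) ∧
      s'.reg 4 = n / Nat.log 2 (n + 2) + 1) ∧ T₀ ≤ T') s T := by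
  have hw' : N + (4 * n + 30) < 2 ^ w := by nlinarith
  have hw0 : w ≠ 0 := by rintro rfl; simp at hw'
  refine .seq (.of_vc ?_ ?_)
  · simp; omega
  simp [hw0]
  refine ⟨by omega, Wp.seq_frame (Q' := fun s' T' => Tables n s' ∧ T₀ + 50 ≤ T')
    (.loop (fun s' T' => 2 ≤ s'.reg 5 ∧ s'.reg 5 ≤ n + 3 ∧
    (∀ y < s'.reg 5, s'.arr 3 y = Nat.log 2 y) ∧
    (∀ y < s'.reg 5, s'.arr 4 y = lowBit y) ∧
    (∀ y < s'.reg 5, 1 ≤ y → s'.arr 5 (Nat.log 2 y) = 2 ^ Nat.log 2 y) ∧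
    T₀ + 60 + 50 * (n + 3 - s'.reg 5) ≤ T') ?_ ?_) ?_⟩
  · simp [h3, h4]
    refine ⟨?_, ?_, ?_, by omega⟩ <;> intro y hy
    · interval_cases y <;> simp
    · rw [lowBit_of_odd (by omega)]
    · intro hy1
      obtain rfl : y = 1 := by omega
      simp
  · intro s' T' hF ⟨hx2, hxn, i3, i4, i5, iT⟩
    have h0 := hF.reg 0 (by decide)
    simp [hn] at h0
    generalize hx : s'.reg 5 = x at *
    refine ⟨?_, ?_, ?_, ?_⟩
    · simp [h0, hx]; omega
    · simp; omega
    · intro hv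
      simp [h0, hx] at hv
      have e : x / 2 < x := by omega
      have hl : Nat.log 2 x = Nat.log 2 (x / 2) + 1 := Nat.log_of_one_lt_of_le (by norm_num) hx2
      have e3 := i3 _ e
      have e4 := i4 _ e
      have e5 := i5 _ e (by omega)
      have l3 : Nat.log 2 (x / 2) ≤ x / 2 := Nat.log_le_self _ _
      have l4 : lowBit (x / 2) ≤ x / 2 := (lowBit_le _).trans l3
      have l5 : 2 ^ Nat.log 2 (x / 2) ≤ x / 2 := Nat.pow_log_le_self _ (by omega)
      generalize Nat.log 2 (x / 2) = L at *
      have k3 : ∀ y < x + 1, Function.update (s'.arr 3) x (L + 1) y = Nat.log 2 y := by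
        intro y hy
        rcases eq_or_ne y x with rfl | hne
        · simp [hl]
        · simpa [hne] using i3 y (by omega)
      have k5 : ∀ y < x + 1, 1 ≤ y →
          Function.update (s'.arr 5) (L + 1) (2 ^ L * 2) (Nat.log 2 y) = 2 ^ Nat.log 2 y := by
        intro y hy hy1
        rw [← pow_succ, ← hl]
        -- Entries for smaller `y` with the same logarithm are overwritten by the same power.
        rcases eq_or_ne (Nat.log 2 y) (Nat.log 2 x) with h | h
        · rw [h, Function.update_self]
        · rw [Function.update_of_ne h]
          exact i5 y (by rcases eq_or_ne y x with rfl | hne <;> [exact absurd rfl h; omega]) hy1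
      refine .of_vc (by simp [tablesStep]; omega) ?_
      simp [tablesStep, hw0, hx, e3, e4, e5, -Order.lt_add_one_iff]
      constructorm* _ ∧ _ <;> try omega
      all_goals
        intro hpar
        constructorm* _ ∧ _ <;> try first | assumption | omega
        intro y hy
        rcases eq_or_ne y x with rfl | hne
      · simp [lowBit_of_even (d := y) (by omega) (by omega)]
      · simpa [hne] using i4 y (by omega)
      · simp [lowBit_of_odd (d := y) (by omega)]
      · simpa [hne] using i4 y (by omega)
    · intro hv
      simp [h0, hx] at hv
      refine ⟨⟨fun y hy => i3 y (by omega), fun y hy => i4 y (by omega), fun j hj => ?_⟩, by simp; omega⟩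
      have := Nat.pow_le_of_le_log (b := 2) (by omega) hj
      simpa using i5 (2 ^ j) (by omega) Nat.one_le_two_pow
  · intro s' T' hF ⟨ht, hT'⟩
    have r0 := hF.reg 0 (by decide)
    have r1 := hF.reg 1 (by decide)
    have a0 := hF.arr 0 (by decide)
    simp [hn] at r0 r1 a0
    have l3 : Nat.log 2 (n + 2) ≤ n + 2 := Nat.log_le_self _ _
    have l1 : 0 < Nat.log 2 (n + 2) := Nat.log_pos (by norm_num) (by omega)
    have hd := Nat.div_le_self n (Nat.log 2 (n + 2))
    refine .of_vc (by simp; omega) ?_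
    simp [r0, r1, a0, hN, hw0, ht.log]
    constructorm* _ ∧ _ <;> try omega
    exact ⟨fun y hy => ht.log y hy, fun y hy => ht.low y hy, fun y hy => ht.pow y hy⟩

end

/-! ### Blocks, the sparse table, and the distribution of the intervals -/

section

/-- The number of rows in a block. -/
def blockSize (n : ℕ) : ℕ := Nat.log 2 (n + 2)

/-- The block that contains row `r`. -/
def blk (n r : ℕ) : ℕ := r / blockSize n

/-- The number of blocks of the rows `0, …, n`.  Row `0` does not belong to the matrix; it is added
so that blocks are quotients of row numbers. -/
def numBlocks (n : ℕ) : ℕ := n / blockSize n + 1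

theorem blockSize_pos (n : ℕ) : 0 < blockSize n := Nat.log_pos (by norm_num) (by omega)

theorem blockSize_le (n : ℕ) : blockSize n ≤ n + 2 := Nat.log_le_self _ _

theorem two_pow_blockSize_le (n : ℕ) : 2 ^ blockSize n ≤ n + 2 :=
  Nat.pow_log_le_self _ (by omega)

theorem numBlocks_pos (n : ℕ) : 0 < numBlocks n := Nat.succ_pos _

theorem numBlocks_le (n : ℕ) : numBlocks n ≤ n + 1 :=
  Nat.succ_le_succ (Nat.div_le_self _ _)

theorem blk_mono (n : ℕ) {r r' : ℕ} (h : r ≤ r') : blk n r ≤ blk n r' := Nat.div_le_div_right h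

theorem blk_lt {n r : ℕ} (h : r ≤ n) : blk n r < numBlocks n :=
  Nat.lt_succ_of_le (blk_mono n h)

theorem blk_le (n r : ℕ) : blk n r ≤ r := Nat.div_le_self _ _

/-- The number of cells of the sparse table. -/
def tableSize (n : ℕ) : ℕ := (Nat.log 2 (numBlocks n) + 1) * numBlocks n

theorem log_numBlocks_le (n : ℕ) : Nat.log 2 (numBlocks n) ≤ blockSize n :=
  Nat.log_mono_right (by have := numBlocks_le n; omega)

theorem log_numBlocks_le' (n : ℕ) : Nat.log 2 (numBlocks n) ≤ n + 1 :=
  (Nat.log_le_self _ _).trans (numBlocks_le n)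

/-- Cell `c` of the sparse table stands for the `2 ^ (c / numBlocks n)` blocks that begin with
block `c % numBlocks n`. -/
def Covers (n c y : ℕ) : Prop :=
  c % numBlocks n ≤ y ∧ y < c % numBlocks n + 2 ^ (c / numBlocks n)

theorem covers_mul_add {n l x y : ℕ} (hx : x < numBlocks n) :
    Covers n (l * numBlocks n + x) y ↔ x ≤ y ∧ y < x + 2 ^ l := by
  rw [Covers, Nat.mul_add_mod_of_lt hx, mul_comm, Nat.mul_add_div (numBlocks_pos n),
    Nat.div_eq_of_lt hx, add_zero]

/-- Two runs of `2 ^ l` blocks, where `l` is the logarithm of the number of blocks strictly between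
`x₁` and `x₂`, cover exactly these blocks. -/
theorem covers_or_covers {n x₁ x₂ l y : ℕ} (h : x₁ + 1 < x₂) (h₂ : x₂ < numBlocks n)
    (hl : l = Nat.log 2 (x₂ - x₁ - 1)) :
    (Covers n (l * numBlocks n + (x₁ + 1)) y ∨ Covers n (l * numBlocks n + (x₂ - 2 ^ l)) y) ↔
      x₁ < y ∧ y < x₂ := by
  have h1 : 2 ^ l ≤ x₂ - x₁ - 1 := hl ▸ Nat.pow_log_le_self 2 (by omega)
  have h2 : x₂ - x₁ - 1 < 2 ^ l * 2 := by
    rw [← pow_succ, hl]; exact Nat.lt_pow_succ_log_self (by norm_num) _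
  have h3 : 0 < 2 ^ l := by positivity
  rw [covers_mul_add (by omega), covers_mul_add (by omega)]
  omega

/-- The intervals with number below `p` that start in row `y` and lie within one block, the last
one first. -/
def bucket (n : ℕ) (a b : ℕ → ℕ) (y : ℕ) : ℕ → List ℕ
  | 0 => []
  | p + 1 => if a p ≤ b p ∧ blk n (a p) = blk n (b p) ∧ a p = y then p :: bucket n a b y p
      else bucket n a b y p

theorem mem_bucket {n : ℕ} {a b : ℕ → ℕ} {y p q : ℕ} :
    q ∈ bucket n a b y p ↔ q < p ∧ a q ≤ b q ∧ blk n (a q) = blk n (b q) ∧ a q = y := by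
  induction p with
  | zero => simp [bucket]
  | succ p ih =>
    have : q < p + 1 ↔ q < p ∨ q = p := by omega
    rw [bucket]
    split_ifs with h
    · rw [List.mem_cons, ih, this]
      constructor
      · rintro (rfl | h')
        · exact ⟨.inr rfl, h⟩
        · exact ⟨.inl h'.1, h'.2⟩
      · rintro ⟨h' | rfl, h2⟩
        · exact .inr ⟨h', h2⟩
        · exact .inl rfl
    · rw [ih, this]
      constructor
      · exact fun h' => ⟨.inl h'.1, h'.2⟩
      · rintro ⟨h' | rfl, h2⟩
        · exact ⟨h', h2⟩
        · exact absurd h2 h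

theorem sum_length_bucket_le (n : ℕ) (a b : ℕ → ℕ) (s : Finset ℕ) (p : ℕ) :
    ∑ y ∈ s, (bucket n a b y p).length ≤ p := by
  induction p with
  | zero => simp [bucket]
  | succ p ih =>
    have h : ∀ y, (bucket n a b y (p + 1)).length ≤
        (bucket n a b y p).length + if y = a p then 1 else 0 := by
      intro y
      rw [bucket]
      split_ifs <;> simp_all
    refine (Finset.sum_le_sum fun y _ => h y).trans ?_
    rw [Finset.sum_add_distrib, Finset.sum_ite_eq']
    split_ifs <;> omega

/-- Starting from link `h`, the links `f` run through the list; link `q + 1` points to item `q`, and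
link `0` ends the list. -/
def Linked (f : ℕ → ℕ) : ℕ → List ℕ → Prop
  | h, [] => h = 0
  | h, q :: l => h = q + 1 ∧ Linked f (f q) l

/-- A list does not depend on the link of an item that it does not contain. -/
theorem Linked.update {f : ℕ → ℕ} {p x : ℕ} : ∀ {h : ℕ} {l : List ℕ}, Linked f h l →
    (∀ q ∈ l, q ≠ p) → Linked (Function.update f p x) h l
  | _, [], h, _ => h
  | _, q :: l, h, hl => by
      refine ⟨h.1, ?_⟩
      rw [Function.update_of_ne (hl q (by simp))]
      exact h.2.update fun q' hq' => hl q' (by simp [hq'])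

variable {α : Type*}

/-- The registers and arrays that keep their contents once the tables have been computed. -/
structure Setting (n N : ℕ) (a b : ℕ → ℕ) (v : ℕ → WithTop α) (s : State α) : Prop
    extends Tables n s where
  reg0 : s.reg 0 = n
  reg2 : s.reg 2 = N
  reg3 : s.reg 3 = blockSize n
  reg4 : s.reg 4 = numBlocks n
  first : s.arr 1 = a
  last : s.arr 2 = b
  value : s.ent 0 = v

theorem Setting.of_frame {n N : ℕ} {a b : ℕ → ℕ} {v : ℕ → WithTop α} {s s' : State α} {p : Prog}
    (h : Setting n N a b v s) (hF : Frame p s s') (hr : ∀ x ∈ p.regs, 5 ≤ x)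
    (ha : ∀ A ∈ p.arrs, 6 ≤ A) (he : ∀ A ∈ p.ents, 1 ≤ A) : Setting n N a b v s' := by
  have hr' : ∀ x < 5, s'.reg x = s.reg x := fun x hx => hF.reg x fun hm => by
    have := hr x hm; omega
  have ha' : ∀ A < 6, s'.arr A = s.arr A := fun x hx => hF.arr x fun hm => by
    have := ha x hm; omega
  have he' : s'.ent 0 = s.ent 0 := hF.ent 0 fun hm => by have := he 0 hm; omega
  exact ⟨⟨fun y hy => by rw [ha' 3 (by norm_num)]; exact h.log y hy,
    fun y hy => by rw [ha' 4 (by norm_num)]; exact h.low y hy,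
    fun y hy => by rw [ha' 5 (by norm_num)]; exact h.pow y hy⟩,
    by rw [hr' 0 (by norm_num), h.reg0], by rw [hr' 2 (by norm_num), h.reg2],
    by rw [hr' 3 (by norm_num), h.reg3], by rw [hr' 4 (by norm_num), h.reg4],
    by rw [ha' 1 (by norm_num), h.first], by rw [ha' 2 (by norm_num), h.last],
    by rw [he', h.value]⟩

theorem Setting.writeReg {n N : ℕ} {a b : ℕ → ℕ} {v : ℕ → WithTop α} {s : State α}
    (h : Setting n N a b v s) {x : ℕ} (hx : 5 ≤ x) (y : ℕ) : Setting n N a b v (s.writeReg x y) :=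
  h.of_frame (p := .setReg x (.const y))
    ⟨fun z hz => by simp_all [Prog.regs], fun _ _ => rfl, fun _ _ => rfl⟩
    (by simpa [Prog.regs] using hx) (by simp [Prog.arrs]) (by simp [Prog.ents])

variable [LinearOrder α]

/-- The first `p` intervals have been distributed.  An interval whose endpoints lie in different
blocks is cut into a final part of its first block, recorded in `suf` at its first row, an initial
part of its last block, recorded in `pre` at its last row, and a run of entire blocks, recorded in
two cells of the sparse table `mid`.  The other intervals are kept in linked lists. -/
structure Scattered (n : ℕ) (a b : ℕ → ℕ) (v : ℕ → WithTop α) (p : ℕ)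
    (suf pre mid : ℕ → WithTop α) (head next : ℕ → ℕ) : Prop where
  suf : ∀ y z, z ≤ suf y ↔
    ∀ q < p, a q ≤ b q ∧ blk n (a q) ≠ blk n (b q) → a q = y → z ≤ v q
  pre : ∀ y z, z ≤ pre y ↔
    ∀ q < p, a q ≤ b q ∧ blk n (a q) ≠ blk n (b q) → b q = y → z ≤ v q
  mid : ∀ y z, (∀ c < tableSize n, Covers n c y → z ≤ mid c) ↔
    ∀ q < p, a q ≤ b q ∧ blk n (a q) ≠ blk n (b q) → blk n (a q) < y ∧ y < blk n (b q) → z ≤ v q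
  chain : ∀ y, Linked next (head y) (bucket n a b y p)

section ScatteredStep

variable {n : ℕ} {a b : ℕ → ℕ} {v : ℕ → WithTop α} {p : ℕ} {suf pre mid : ℕ → WithTop α}
  {head next : ℕ → ℕ}

theorem Scattered.zero : Scattered n a b v 0 (fun _ => ⊤) (fun _ => ⊤) (fun _ => ⊤) (fun _ => 0)
    next :=
  ⟨by simp, by simp, by simp, by simp [bucket, Linked]⟩

theorem Scattered.of_empty (h : Scattered n a b v p suf pre mid head next) (hp : b p < a p) :
    Scattered n a b v (p + 1) suf pre mid head next := by
  have hn : ¬ a p ≤ b p := by omega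
  refine ⟨?_, ?_, ?_, ?_⟩
  · simpa [Nat.forall_lt_succ_right, -Order.lt_add_one_iff, hn] using h.suf
  · simpa [Nat.forall_lt_succ_right, -Order.lt_add_one_iff, hn] using h.pre
  · simpa [Nat.forall_lt_succ_right, -Order.lt_add_one_iff, hn] using h.mid
  · simpa [bucket, hn] using h.chain

theorem Scattered.of_same (h : Scattered n a b v p suf pre mid head next) (hp : a p ≤ b p)
    (hb : blk n (a p) = blk n (b p)) :
    Scattered n a b v (p + 1) suf pre mid (Function.update head (a p) (p + 1))
      (Function.update next p (head (a p))) := by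
  refine ⟨?_, ?_, ?_, ?_⟩
  · simpa [Nat.forall_lt_succ_right, -Order.lt_add_one_iff, hb] using h.suf
  · simpa [Nat.forall_lt_succ_right, -Order.lt_add_one_iff, hb] using h.pre
  · simpa [Nat.forall_lt_succ_right, -Order.lt_add_one_iff, hb] using h.mid
  · intro y
    have hc := (h.chain y).update (p := p) (x := head (a p))
      fun q hq => by have := (mem_bucket.1 hq).1; omega
    by_cases hy : a p = y
    · subst hy
      simpa [bucket, hp, hb, Linked] using hc
    · simpa [bucket, hy, Ne.symm hy] using hc

theorem le_update_min_iff_forall {C : ℕ → Prop} {key : ℕ → ℕ} {f : ℕ → WithTop α}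
    (h : ∀ y z, z ≤ f y ↔ ∀ q < p, C q → key q = y → z ≤ v q) (hp : C p) (y : ℕ) (z : WithTop α) :
    z ≤ Function.update f (key p) (min (f (key p)) (v p)) y ↔
      ∀ q < p + 1, C q → key q = y → z ≤ v q := by
  rw [le_update_min_iff, h, Nat.forall_lt_succ_right]
  constructor
  · exact fun ⟨h1, h2⟩ => ⟨h1, fun _ hk => h2 hk.symm⟩
  · exact fun ⟨h1, h2⟩ => ⟨h1, fun hk => h2 hp hk.symm⟩

theorem Scattered.of_adjacent (h : Scattered n a b v p suf pre mid head next) (hp : a p ≤ b p)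
    (hb : blk n (a p) ≠ blk n (b p)) (hadj : ¬ blk n (a p) + 1 < blk n (b p)) :
    Scattered n a b v (p + 1) (Function.update suf (a p) (min (suf (a p)) (v p)))
      (Function.update pre (b p) (min (pre (b p)) (v p))) mid head next := by
  refine ⟨le_update_min_iff_forall h.suf ⟨hp, hb⟩, le_update_min_iff_forall h.pre ⟨hp, hb⟩, ?_, ?_⟩
  · intro y z
    rw [h.mid, Nat.forall_lt_succ_right]
    exact ⟨fun h1 => ⟨h1, fun _ _ => by omega⟩, fun h1 => h1.1⟩
  · simpa [bucket, hb] using h.chain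

theorem Scattered.of_apart (h : Scattered n a b v p suf pre mid head next) (hp : a p ≤ b p)
    (hb : blk n (a p) + 1 < blk n (b p)) (hbn : b p ≤ n) {l c₁ c₂ : ℕ}
    (hl : l = Nat.log 2 (blk n (b p) - blk n (a p) - 1))
    (hc₁ : c₁ = l * numBlocks n + (blk n (a p) + 1))
    (hc₂ : c₂ = l * numBlocks n + (blk n (b p) - 2 ^ l)) {mid₁ mid₂ : ℕ → WithTop α}
    (hm₁ : mid₁ = Function.update mid c₁ (min (mid c₁) (v p)))
    (hm₂ : mid₂ = Function.update mid₁ c₂ (min (mid₁ c₂) (v p))) :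
    Scattered n a b v (p + 1) (Function.update suf (a p) (min (suf (a p)) (v p)))
      (Function.update pre (b p) (min (pre (b p)) (v p))) mid₂ head next := by
  have hne : blk n (a p) ≠ blk n (b p) := by omega
  have hx : blk n (b p) < numBlocks n := blk_lt hbn
  have hll : l ≤ Nat.log 2 (numBlocks n) := hl ▸ Nat.log_mono_right (by omega)
  have hlt : ∀ x < numBlocks n, l * numBlocks n + x < tableSize n := fun x hx => by
    have := Nat.mul_le_mul_right (numBlocks n) hll
    rw [tableSize, Nat.add_mul, Nat.one_mul]
    omega
  refine ⟨le_update_min_iff_forall h.suf ⟨hp, hne⟩, le_update_min_iff_forall h.pre ⟨hp, hne⟩, ?_, ?_⟩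
  · intro y z
    have hcov := covers_or_covers (y := y) hb hx hl
    rw [← hc₁, ← hc₂] at hcov
    have h1 := hlt (blk n (a p) + 1) (by omega)
    have h2 := hlt (blk n (b p) - 2 ^ l) ((Nat.sub_le _ _).trans_lt hx)
    rw [← hc₁] at h1
    rw [← hc₂] at h2
    rw [Nat.forall_lt_succ_right, ← h.mid, ← hcov]
    simp only [hm₂, le_update_min_iff]
    simp only [hm₁, le_update_min_iff]
    constructor
    · refine fun H => ⟨fun c hc hcy => (H c hc hcy).1.1, ?_⟩
      rintro - (hy | hy)
      · exact (H _ h1 hy).1.2 rfl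
      · exact (H _ h2 hy).2 rfl
    · rintro ⟨H1, H2⟩ c hc hcy
      refine ⟨⟨H1 c hc hcy, ?_⟩, ?_⟩ <;> rintro rfl
      · exact H2 ⟨hp, hne⟩ (.inl hcy)
      · exact H2 ⟨hp, hne⟩ (.inr hcy)
  · simpa [bucket, hne] using h.chain

end ScatteredStep

end

/-! ### The program that distributes the intervals -/

section

/-- Distribute interval `p` (register `5`). -/
def scatterStep : Prog :=
  .setReg 6 (.cell 1 (.reg 5)) ;;
  .setReg 7 (.cell 2 (.reg 5)) ;;
  .setReg 8 (.reg 6 /ʷ .reg 3) ;;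
  .setReg 9 (.reg 7 /ʷ .reg 3) ;;
  .ite (.lt (.reg 7) (.reg 6)) .skip
    (.ite (.eq (.reg 8) (.reg 9))
      (.setArr 7 (.reg 5) (.cell 6 (.reg 6)) ;;
       .setArr 6 (.reg 6) (.reg 5 +ʷ .const 1))
      (minInto 3 (.reg 6) 0 (.reg 5) ;;
       minInto 4 (.reg 7) 0 (.reg 5) ;;
       .ite (.lt (.reg 8 +ʷ .const 1) (.reg 9))
        (.setReg 10 (.cell 3 (.reg 9 -ʷ .reg 8 -ʷ .const 1)) ;;
         .setReg 11 (.reg 10 *ʷ .reg 4) ;;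
         minInto 2 (.reg 11 +ʷ (.reg 8 +ʷ .const 1)) 0 (.reg 5) ;;
         minInto 2 (.reg 11 +ʷ (.reg 9 -ʷ .cell 5 (.reg 10))) 0 (.reg 5))
        .skip)) ;;
  .setReg 5 (.reg 5 +ʷ .const 1)

/-- Distribute all intervals. -/
def scatter : Prog :=
  .setReg 5 (.const 0) ;;
  .while (.lt (.reg 5) (.reg 2)) scatterStep

variable {α : Type*} [LinearOrder α]

@[simp] theorem maxCost_minInto (A A' : ℕ) (i j : WExp) :
    (minInto A i A' j).maxCost = 2 * i.cost + 2 * j.cost + 6 := by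
  simp [minInto]; omega

theorem scatter_spec {w n N T₀ T : ℕ} {a b : ℕ → ℕ} {v : ℕ → WithTop α} {s : State α}
    (hw : N + 4 * (n + 3) ^ 2 < 2 ^ w) (hab : ∀ q < N, a q ≤ n + 1 ∧ b q ≤ n)
    (hs : Setting n N a b v s)
    (h0 : Scattered n a b v 0 (s.ent 3) (s.ent 4) (s.ent 2) (s.arr 6) (s.arr 7))
    (h6 : ∀ y, s.arr 6 y = 0)
    (hT : T₀ + 200 * (N + 1) ≤ T) :
    Wp w scatter (fun s' T' =>
      Scattered n a b v N (s'.ent 3) (s'.ent 4) (s'.ent 2) (s'.arr 6) (s'.arr 7) ∧ T₀ ≤ T') s T := by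
  have hw' : N + (4 * n + 30) < 2 ^ w := by nlinarith
  have hw0 : w ≠ 0 := by rintro rfl; simp at hw'
  refine .seq (.of_vc (by simp; omega) ?_)
  simp
  refine .loop (fun s' T' => s'.reg 5 ≤ N ∧ (∀ y, s'.arr 6 y ≤ N) ∧
    Scattered n a b v (s'.reg 5) (s'.ent 3) (s'.ent 4) (s'.ent 2) (s'.arr 6) (s'.arr 7) ∧
    T₀ + 10 + 150 * (N - s'.reg 5) ≤ T') ?_ ?_
  · simp [h6, h0]; omega
  intro s' T' hF ⟨hp, hh, hsc, hT'⟩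
  have hs' : Setting n N a b v s' :=
    (hs.writeReg le_rfl 0).of_frame hF (by decide) (by decide) (by decide)
  generalize hx : s'.reg 5 = p at *
  refine ⟨?_, ?_, ?_, ?_⟩
  · simp [hx, hs'.reg2]; omega
  · simp; omega
  · intro hv
    simp [hx, hs'.reg2] at hv
    obtain ⟨ha, hb⟩ := hab p hv
    refine .of_vc (by simp [scatterStep]; omega) ?_
    have hB := blockSize_le n
    have hB0 := blockSize_pos n
    have hnb := numBlocks_le n
    have e1 : a p / blockSize n = blk n (a p) := rfl
    have e2 : b p / blockSize n = blk n (b p) := rfl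
    have l1 := blk_le n (a p)
    have l2 := blk_le n (b p)
    simp [scatterStep, hw0, hx, hs'.first, hs'.last, hs'.value, hs'.reg3, hs'.reg4, e1, e2]
    have hl2 : ∀ y, s'.arr 6 y < 2 ^ w := fun y => (hh y).trans_lt (by omega)
    have hup : ∀ y, Function.update (s'.arr 6) (a p) (p + 1) y ≤ N := fun y => by
      rw [Function.update_apply]
      split_ifs
      exacts [hv, hh y]
    have hl6 := hl2 (a p)
    constructorm* _ ∧ _ <;> try omega
    · intro h
      exact ⟨by omega, hv, hh, hsc.of_empty h, by omega⟩
    · intro h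
      constructorm* _ ∧ _ <;> try omega
      · intro h'
        constructorm* _ ∧ _ <;> try first | omega | assumption
        exact hsc.of_same h h'
      intro h'
      constructorm* _ ∧ _ <;> try omega
      · intro h2
        have hx2 : blk n (b p) < numBlocks n := blk_lt hb
        obtain ⟨l, hl⟩ : ∃ l, l = Nat.log 2 (blk n (b p) - blk n (a p) - 1) := ⟨_, rfl⟩
        have hll : l ≤ Nat.log 2 (numBlocks n) := hl ▸ Nat.log_mono_right (by omega)
        have hl3 := hll.trans (log_numBlocks_le' n)
        have hpow : 2 ^ l ≤ blk n (b p) - blk n (a p) - 1 := hl ▸ Nat.pow_log_le_self 2 (by omega)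
        have hmul : l * numBlocks n ≤ (n + 1) * (n + 1) := Nat.mul_le_mul hl3 hnb
        have hsq : (n + 1) * (n + 1) + 4 * (n + 2) ≤ 4 * (n + 3) ^ 2 := by nlinarith
        rw [hs'.log _ (by omega), ← hl, hs'.pow l (hll.trans (log_numBlocks_le n))]
        constructorm* _ ∧ _ <;> try first | omega | assumption
        · exact lt_of_le_of_lt (Nat.add_le_add_left (Nat.sub_le _ _) _) (by omega)
        · exact hsc.of_apart h h2 hb hl rfl rfl rfl rfl
      · intro h2
        exact ⟨by omega, hv, hh, hsc.of_adjacent h h' (by omega), by omega⟩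
  · intro hv
    simp [hx, hs'.reg2] at hv
    obtain rfl : p = N := by omega
    exact ⟨hsc, by simp; omega⟩

end

/-! ### Resolving the sparse table and the parts of blocks -/

section

/-- With blocks of logarithmic size, the sparse table for the blocks has linear size. -/
theorem tableSize_le_linear (n : ℕ) : tableSize n ≤ 3 * (n + 1) := by
  have h1 := Nat.mul_le_mul_right (numBlocks n) (Nat.succ_le_succ (log_numBlocks_le n))
  have h2 := Nat.mul_div_le n (blockSize n)
  have h3 := Nat.div_le_self n (blockSize n)
  have h4 := blockSize_le n
  refine h1.trans ?_
  rw [numBlocks, Nat.succ_eq_add_one]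
  nlinarith

/-- A run of `2 ^ l` blocks consists of two runs of half the length, the second of which may
begin after the last block. -/
theorem covers_halves {n c y : ℕ} (hc : numBlocks n ≤ c) (hy : y < numBlocks n) :
    Covers n c y ↔ Covers n (c - numBlocks n) y ∨
      (c - c / numBlocks n * numBlocks n + 2 ^ (c / numBlocks n - 1) < numBlocks n ∧
        Covers n (c - numBlocks n + 2 ^ (c / numBlocks n - 1)) y) := by
  have hpos := numBlocks_pos n
  have hx := Nat.mod_lt c hpos
  have hdiv := Nat.div_add_mod' c (numBlocks n)
  have hl : 0 < c / numBlocks n := Nat.div_pos hc hpos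
  obtain ⟨l, hl⟩ : ∃ l, c / numBlocks n = l + 1 := ⟨_, (Nat.succ_pred_eq_of_pos hl).symm⟩
  have hcov : Covers n c y ↔ c % numBlocks n ≤ y ∧ y < c % numBlocks n + 2 ^ (l + 1) := by
    rw [Covers, hl]
  rw [hcov, hl, Nat.add_sub_cancel]
  rw [hl] at hdiv
  generalize c % numBlocks n = x at *
  subst hdiv
  have e1 : (l + 1) * numBlocks n + x - numBlocks n = l * numBlocks n + x := by
    rw [Nat.add_mul]; omega
  have hp : 0 < 2 ^ l := by positivity
  rw [e1, Nat.add_sub_cancel_left, covers_mul_add hx, add_assoc, pow_succ]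
  by_cases h : x + 2 ^ l < numBlocks n
  · rw [covers_mul_add h]
    generalize 2 ^ l = P at *
    omega
  · generalize 2 ^ l = P at *
    simp only [h, false_and, or_false]
    omega

/-- Pass the content of the last unresolved cell of the sparse table to the cells for its two halves,
unless the second half begins after the last block. -/
def pushDownStep : Prog :=
  .setReg 5 (.reg 5 -ʷ .const 1) ;;
  .setReg 6 (.reg 5 /ʷ .reg 4) ;;
  .setReg 7 (.cell 5 (.reg 6 -ʷ .const 1)) ;;
  minInto 2 (.reg 5 -ʷ .reg 4) 2 (.reg 5) ;;
  .ite (.lt (.reg 5 -ʷ .reg 6 *ʷ .reg 4 +ʷ .reg 7) (.reg 4))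
    (minInto 2 (.reg 5 -ʷ .reg 4 +ʷ .reg 7) 2 (.reg 5)) .skip

/-- Resolve the sparse table from the last cell downwards.  A cell only receives values from cells with
larger numbers, hence its content is final when it is passed on. -/
def pushDown : Prog :=
  .setReg 5 ((.cell 3 (.reg 4) +ʷ .const 1) *ʷ .reg 4) ;;
  .while (.lt (.reg 4) (.reg 5)) pushDownStep

/-- Update the running minimum at the row after row `r` (register `5`) if it is in the same block. -/
def suffixStep : Prog :=
  .ite (.eq (.reg 5 /ʷ .reg 3) ((.reg 5 +ʷ .const 1) /ʷ .reg 3))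
    (minInto 3 (.reg 5 +ʷ .const 1) 3 (.reg 5)) .skip ;;
  .setReg 5 (.reg 5 +ʷ .const 1)

/-- Replace entry array `3` by its running minima from the beginning of each block. -/
def suffixMinima : Prog :=
  .setReg 5 (.const 0) ;;
  .while (.lt (.reg 5) (.reg 0)) suffixStep

/-- Update the running minimum at the row before row `r` (register `5`) if it is in the same block. -/
def prefixStep : Prog :=
  .setReg 5 (.reg 5 -ʷ .const 1) ;;
  .ite (.eq (.reg 5 /ʷ .reg 3) ((.reg 5 +ʷ .const 1) /ʷ .reg 3))
    (minInto 4 (.reg 5) 4 (.reg 5 +ʷ .const 1)) .skip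

/-- Replace entry array `4` by its running minima from the end of each block. -/
def prefixMinima : Prog :=
  .setReg 5 (.reg 0) ;;
  .while (.lt (.const 0) (.reg 5)) prefixStep

variable {α : Type*} [LinearOrder α]

/-- In the loop, the unresolved cells and the bottom row keep the same lower bounds for each block. -/
theorem pushDown_spec {w n N T₀ T : ℕ} {a b : ℕ → ℕ} {v : ℕ → WithTop α} {s : State α}
    (hw : N + 4 * (n + 3) ^ 2 < 2 ^ w) (hs : Setting n N a b v s) (hT : T₀ + 300 * (n + 2) ≤ T) :
    Wp w pushDown (fun s' T' => (∀ y < numBlocks n, ∀ z, z ≤ s'.ent 2 y ↔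
      ∀ c < tableSize n, Covers n c y → z ≤ s.ent 2 c) ∧ T₀ ≤ T') s T := by
  have hw' : N + (4 * n + 30) < 2 ^ w := by nlinarith
  have hw0 : w ≠ 0 := by rintro rfl; simp at hw'
  have hpos := numBlocks_pos n
  have hnb := numBlocks_le n
  have hts := tableSize_le_linear n
  have htn : numBlocks n ≤ tableSize n := by
    rw [tableSize, Nat.add_mul]; omega
  refine .seq (.of_vc (by simp; omega) ?_)
  have hll := log_numBlocks_le' n
  have hdef : (Nat.log 2 (numBlocks n) + 1) * numBlocks n = tableSize n := rfl
  simp [hs.reg4, hs.log _ (hnb.trans (by omega)), hw0, hdef]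
  constructorm* _ ∧ _ <;> try omega
  refine .loop (fun s' T' => numBlocks n ≤ s'.reg 5 ∧ s'.reg 5 ≤ tableSize n ∧
    (∀ y < numBlocks n, ∀ z, (∀ c < s'.reg 5, Covers n c y → z ≤ s'.ent 2 c) ↔
      ∀ c < tableSize n, Covers n c y → z ≤ s.ent 2 c) ∧
    T₀ + 10 + 80 * (s'.reg 5 - numBlocks n) ≤ T') ?_ ?_
  · simp
    omega
  intro s' T' hF ⟨hc1, hc2, hI, hT'⟩
  have hs' : Setting n N a b v s' :=
    (hs.writeReg le_rfl _).of_frame hF (by decide) (by decide) (by decide)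
  generalize hx : s'.reg 5 = c' at *
  refine ⟨?_, ?_, ?_, ?_⟩
  · simp [hx, hs'.reg4]; omega
  · simp; omega
  · intro hv
    simp [hx, hs'.reg4] at hv
    obtain ⟨c, rfl⟩ : ∃ c, c' = c + 1 := ⟨c' - 1, by omega⟩
    have hcn : numBlocks n ≤ c := by omega
    have hl : c / numBlocks n < Nat.log 2 (numBlocks n) + 1 := by
      rw [Nat.div_lt_iff_lt_mul hpos, hdef]; omega
    have hl' : c / numBlocks n - 1 ≤ blockSize n := by
      have := log_numBlocks_le n; omega
    have hpow : 2 ^ (c / numBlocks n - 1) ≤ n + 2 :=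
      (Nat.pow_le_pow_right (by norm_num) hl').trans (two_pow_blockSize_le n)
    have hmul := Nat.div_mul_le_self c (numBlocks n)
    have hcov := fun y (hy : y < numBlocks n) => covers_halves (y := y) hcn hy
    have hp0 : 0 < 2 ^ (c / numBlocks n - 1) := by positivity
    refine .of_vc (by simp [pushDownStep]; omega) ?_
    simp [pushDownStep, hw0, hx, hs'.reg4]
    rw [hs'.pow _ hl']
    generalize 2 ^ (c / numBlocks n - 1) = P at *
    generalize c / numBlocks n * numBlocks n = Q at *
    constructorm* _ ∧ _ <;> try omega
    · intro h
      constructorm* _ ∧ _ <;> try omega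
      intro y hy z
      rw [← hI y hy z, Nat.forall_lt_succ_right, hcov y hy]
      have hne : c - numBlocks n ≠ c := by omega
      simp only [le_update_min_iff, Function.update_of_ne hne.symm]
      constructor
      · intro H
        refine ⟨fun d hd hdy => (H d hd hdy).1.1, ?_⟩
        rintro (h1 | ⟨-, h1⟩)
        · exact (H _ (by omega) h1).1.2 rfl
        · exact (H _ (by omega) h1).2 rfl
      · rintro ⟨H1, H2⟩ d hd hdy
        refine ⟨⟨H1 d hd hdy, ?_⟩, ?_⟩ <;> rintro rfl
        · exact H2 (.inl hdy)
        · exact H2 (.inr ⟨h, hdy⟩)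
    · intro h
      constructorm* _ ∧ _ <;> try omega
      intro y hy z
      rw [← hI y hy z, Nat.forall_lt_succ_right, hcov y hy]
      simp only [le_update_min_iff]
      constructor
      · intro H
        refine ⟨fun d hd hdy => (H d hd hdy).1, ?_⟩
        rintro (h1 | ⟨h1, -⟩)
        · exact (H _ (by omega) h1).2 rfl
        · omega
      · rintro ⟨H1, H2⟩ d hd hdy
        refine ⟨H1 d hd hdy, ?_⟩
        rintro rfl
        exact H2 (.inl hdy)
  · intro hv
    simp [hx, hs'.reg4] at hv
    obtain rfl : c' = numBlocks n := by omega
    refine ⟨fun y hy z => ?_, by simp; omega⟩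
    rw [← hI y hy z]
    -- A cell of the bottom row stands for a single block.
    have hcov : ∀ c < numBlocks n, Covers n c y ↔ c = y := fun c hc => by
      rw [Covers, Nat.mod_eq_of_lt hc, Nat.div_eq_of_lt hc]; omega
    exact ⟨fun h c hc hcy => (hcov c hc).1 hcy ▸ h, fun h => h y hy ((hcov y hy).2 rfl)⟩

theorem suffixMinima_spec {w n N T₀ T : ℕ} {a b : ℕ → ℕ} {v : ℕ → WithTop α} {s : State α}
    (hw : N + 4 * (n + 3) ^ 2 < 2 ^ w) (hs : Setting n N a b v s) (hT : T₀ + 100 * (n + 2) ≤ T) :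
    Wp w suffixMinima (fun s' T' => (∀ y ≤ n, ∀ z, z ≤ s'.ent 3 y ↔
      ∀ x ≤ y, blk n x = blk n y → z ≤ s.ent 3 x) ∧ T₀ ≤ T') s T := by
  have hw' : N + (4 * n + 30) < 2 ^ w := by nlinarith
  have hw0 : w ≠ 0 := by rintro rfl; simp at hw'
  refine .seq (.of_vc (by simp; omega) ?_)
  simp
  refine .loop (fun s' T' => s'.reg 5 ≤ n ∧
    (∀ y ≤ s'.reg 5, ∀ z, z ≤ s'.ent 3 y ↔ ∀ x ≤ y, blk n x = blk n y → z ≤ s.ent 3 x) ∧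
    (∀ y, s'.reg 5 < y → s'.ent 3 y = s.ent 3 y) ∧
    T₀ + 10 + 80 * (n - s'.reg 5) ≤ T') ?_ ?_
  · simp
    omega
  intro s' T' hF ⟨hr, hI, hI', hT'⟩
  have hs' : Setting n N a b v s' :=
    (hs.writeReg le_rfl _).of_frame hF (by decide) (by decide) (by decide)
  generalize hx : s'.reg 5 = r at *
  refine ⟨?_, ?_, ?_, ?_⟩
  · simp [hx, hs'.reg0]; omega
  · simp; omega
  · intro hv
    simp [hx, hs'.reg0] at hv
    have hB := blockSize_le n
    have hB0 := blockSize_pos n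
    have e1 : r / blockSize n = blk n r := rfl
    have e2 : (r + 1) / blockSize n = blk n (r + 1) := rfl
    have l1 := blk_le n r
    have l2 := blk_le n (r + 1)
    refine .of_vc (by simp [suffixStep]; omega) ?_
    simp [suffixStep, hw0, hx, hs'.reg3, e1, e2, -Order.lt_add_one_iff, -Order.add_one_le_iff]
    have key : ∀ z, (∀ x ≤ r + 1, blk n x = blk n (r + 1) → z ≤ s.ent 3 x) ↔
        z ≤ s.ent 3 (r + 1) ∧ (blk n r = blk n (r + 1) → z ≤ s'.ent 3 r) := by
      intro z
      rw [hI r le_rfl]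
      constructor
      · exact fun H => ⟨H _ le_rfl rfl, fun h x hx hxr => H x (by omega) (hxr.trans h)⟩
      · rintro ⟨H1, H2⟩ x hxr hxb
        rcases eq_or_ne x (r + 1) with rfl | hne
        · exact H1
        · have h3 := blk_mono n (show x ≤ r by omega)
          have h4 := blk_mono n (show r ≤ r + 1 by omega)
          exact H2 (by omega) x (by omega) (by omega)
    constructorm* _ ∧ _ <;> try omega
    all_goals
      intro h
      constructorm* _ ∧ _ <;> try omega
    · intro y hy z
      rw [le_update_min_iff]
      rcases eq_or_ne y (r + 1) with rfl | hne
      · rw [key, hI' _ (by omega)]; simp [h]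
      · rw [hI y (by omega)]; simp [hne]
    · intro y hy
      rw [Function.update_of_ne (by omega), hI' y (by omega)]
    · intro y hy z
      rcases eq_or_ne y (r + 1) with rfl | hne
      · rw [key, hI' _ (by omega)]; simp [h]
      · rw [hI y (by omega)]
    · intro y hy
      rw [hI' y (by omega)]
  · intro hv
    simp [hx, hs'.reg0] at hv
    obtain rfl : r = n := by omega
    exact ⟨hI, by simp; omega⟩

theorem prefixMinima_spec {w n N T₀ T : ℕ} {a b : ℕ → ℕ} {v : ℕ → WithTop α} {s : State α}
    (hw : N + 4 * (n + 3) ^ 2 < 2 ^ w) (hs : Setting n N a b v s) (hT : T₀ + 100 * (n + 2) ≤ T) :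
    Wp w prefixMinima (fun s' T' => (∀ y ≤ n, ∀ z, z ≤ s'.ent 4 y ↔
      ∀ x ≤ n, y ≤ x → blk n x = blk n y → z ≤ s.ent 4 x) ∧ T₀ ≤ T') s T := by
  have hw' : N + (4 * n + 30) < 2 ^ w := by nlinarith
  have hw0 : w ≠ 0 := by rintro rfl; simp at hw'
  refine .seq (.of_vc (by simp; omega) ?_)
  simp [hs.reg0]
  refine ⟨by omega, .loop (fun s' T' => s'.reg 5 ≤ n ∧
    (∀ y ≤ n, s'.reg 5 ≤ y → ∀ z, z ≤ s'.ent 4 y ↔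
      ∀ x ≤ n, y ≤ x → blk n x = blk n y → z ≤ s.ent 4 x) ∧
    (∀ y < s'.reg 5, s'.ent 4 y = s.ent 4 y) ∧
    T₀ + 10 + 80 * s'.reg 5 ≤ T') ?_ ?_⟩
  · simp
    refine ⟨fun y hy hy' z => ?_, by omega⟩
    obtain rfl : y = n := by omega
    exact ⟨fun h x hx hx' _ => (show x = y by omega) ▸ h, fun h => h _ le_rfl le_rfl rfl⟩
  intro s' T' hF ⟨hr, hI, hI', hT'⟩
  have hs' : Setting n N a b v s' :=
    (hs.writeReg le_rfl _).of_frame hF (by decide) (by decide) (by decide)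
  generalize hx : s'.reg 5 = r' at *
  refine ⟨?_, ?_, ?_, ?_⟩
  · simp [hx]; omega
  · simp; omega
  · intro hv
    simp [hx] at hv
    obtain ⟨r, rfl⟩ : ∃ r, r' = r + 1 := ⟨r' - 1, by omega⟩
    have hB := blockSize_le n
    have hB0 := blockSize_pos n
    have e1 : r / blockSize n = blk n r := rfl
    have e2 : (r + 1) / blockSize n = blk n (r + 1) := rfl
    have l1 := blk_le n r
    have l2 := blk_le n (r + 1)
    refine .of_vc (by simp [prefixStep]; omega) ?_
    simp [prefixStep, hw0, hx, hs'.reg3, e1, e2, -Order.lt_add_one_iff, -Order.add_one_le_iff]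
    have key : ∀ z, (∀ x ≤ n, r ≤ x → blk n x = blk n r → z ≤ s.ent 4 x) ↔
        z ≤ s.ent 4 r ∧ (blk n r = blk n (r + 1) → z ≤ s'.ent 4 (r + 1)) := by
      intro z
      rw [hI (r + 1) hr le_rfl]
      constructor
      · exact fun H => ⟨H _ (by omega) le_rfl rfl,
          fun h x hx hxr hb => H x (by omega) (by omega) (hb.trans h.symm)⟩
      · rintro ⟨H1, H2⟩ x hxn hxr hxb
        rcases eq_or_ne x r with rfl | hne
        · exact H1
        · have h3 := blk_mono n (show r + 1 ≤ x by omega)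
          have h4 := blk_mono n (show r ≤ r + 1 by omega)
          exact H2 (by omega) x hxn (by omega) (by omega)
    constructorm* _ ∧ _ <;> try omega
    all_goals
      intro h
      constructorm* _ ∧ _ <;> try omega
    · intro y hy hy' z
      rw [le_update_min_iff]
      rcases eq_or_ne y r with rfl | hne
      · rw [key, hI' _ (by omega)]; simp [h]
      · rw [hI y hy (by omega)]; simp [hne]
    · intro y hy
      rw [Function.update_of_ne (by omega), hI' y (by omega)]
    · intro y hy hy' z
      rcases eq_or_ne y r with rfl | hne
      · rw [key, hI' _ (by omega)]; simp [h]
      · rw [hI y hy (by omega)]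
    · intro y hy
      rw [hI' y (by omega)]
  · intro hv
    simp [hx] at hv
    subst hv
    exact ⟨fun y hy => hI y hy (by omega), by simp; omega⟩

end

/-! ### Staircases -/

section

section Stair

variable {α : Type*} [LinearOrder α]

theorem blk_mul_add_mod (n e : ℕ) : blk n e * blockSize n + e % blockSize n = e :=
  Nat.div_add_mod' e _

theorem blk_mul_add {n x i : ℕ} (hi : i < blockSize n) : blk n (x * blockSize n + i) = x := by
  rw [blk, mul_comm, Nat.mul_add_div (blockSize_pos n), Nat.div_eq_of_lt hi, add_zero]

/-- A staircase: a set `F` of rows, stored as one bit mask per block, with a value for each of its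
rows such that within each block the values increase. -/
structure Stair (n : ℕ) (mask : ℕ → ℕ) (val : ℕ → WithTop α) (F : Finset ℕ) : Prop where
  bits : ∀ x i, (mask x).testBit i = true ↔ i < blockSize n ∧ x * blockSize n + i ∈ F
  mono : ∀ e ∈ F, ∀ e' ∈ F, blk n e = blk n e' → e < e' → val e < val e'

/-- `z` is a lower bound of the values of the staircase at and after row `y` in the block of `y`. -/
def StairLe (n : ℕ) (val : ℕ → WithTop α) (F : Finset ℕ) (y : ℕ) (z : WithTop α) : Prop :=
  ∀ e ∈ F, y ≤ e → blk n e = blk n y → z ≤ val e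

variable {n : ℕ} {mask : ℕ → ℕ} {val : ℕ → WithTop α} {F : Finset ℕ}

theorem Stair.mask_lt (h : Stair n mask val F) (x : ℕ) : mask x < 2 ^ blockSize n :=
  Nat.lt_pow_two_of_testBit _ fun i hi => by
    rw [Bool.eq_false_iff]
    intro hb
    have := ((h.bits x i).1 hb).1
    omega

theorem Stair.testBit_iff (h : Stair n mask val F) (e : ℕ) :
    (mask (blk n e)).testBit (e % blockSize n) = true ↔ e ∈ F := by
  rw [h.bits, blk_mul_add_mod]
  simp [Nat.mod_lt _ (blockSize_pos n)]

theorem blk_eq_le_iff {e e' : ℕ} (h : blk n e' = blk n e) :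
    e % blockSize n ≤ e' % blockSize n ↔ e ≤ e' := by
  have h1 := blk_mul_add_mod n e
  have h2 := blk_mul_add_mod n e'
  rw [h] at h2
  omega

/-- If no mask bit is left at or above the position of `e`, no step of the block is at or after `e`. -/
theorem Stair.no_succ (h : Stair n mask val F) {e : ℕ}
    (h0 : mask (blk n e) / 2 ^ (e % blockSize n) = 0) :
    ∀ e' ∈ F, e ≤ e' → blk n e' ≠ blk n e := by
  intro e' he' hle hb
  have := (h.testBit_iff e').2 he'
  rw [hb, div_two_pow_eq_zero h0 ((blk_eq_le_iff hb).2 hle)] at this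
  cases this

/-- The first step at or after row `e` in the block of `e`. -/
theorem Stair.succ (h : Stair n mask val F) {e d : ℕ}
    (hd : d = mask (blk n e) / 2 ^ (e % blockSize n)) (h0 : d ≠ 0) :
    e + lowBit d ∈ F ∧ blk n (e + lowBit d) = blk n e ∧
      ∀ e' ∈ F, e ≤ e' → blk n e' = blk n e → e + lowBit d ≤ e' := by
  subst hd
  obtain ⟨h1, h2⟩ := lowBit_div_spec h0
  generalize lowBit _ = t at *
  have h3 := (h.bits _ _).1 h1
  have h4 := blk_mul_add_mod n e
  have h5 := blk_mul_add (x := blk n e) h3.1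
  rw [← add_assoc, h4] at h3 h5
  refine ⟨h3.2, h5, fun e' he' hle hb => ?_⟩
  have h6 := h2 (e' % blockSize n) ((blk_eq_le_iff hb).2 hle) (hb ▸ (h.testBit_iff e').2 he')
  have h7 := blk_mul_add_mod n e'
  rw [hb] at h7
  omega

theorem Stair.no_pred (h : Stair n mask val F) {e : ℕ}
    (h0 : mask (blk n e) % 2 ^ (e % blockSize n + 1) = 0) :
    ∀ e' ∈ F, e' ≤ e → blk n e' ≠ blk n e := by
  intro e' he' hle hb
  have := (h.testBit_iff e').2 he'
  rw [hb, mod_two_pow_eq_zero h0 ((blk_eq_le_iff hb.symm).2 hle)] at this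
  cases this

/-- The last step at or before row `e` in the block of `e`. -/
theorem Stair.pred (h : Stair n mask val F) {e d u : ℕ}
    (hd : d = mask (blk n e) % 2 ^ (e % blockSize n + 1)) (h0 : d ≠ 0)
    (hu : u = blk n e * blockSize n + Nat.log 2 d) :
    Nat.log 2 d = u % blockSize n ∧ u ∈ F ∧ u ≤ e ∧ blk n u = blk n e ∧
      ∀ e' ∈ F, e' ≤ e → blk n e' = blk n e → e' ≤ u := by
  subst hd
  obtain ⟨h1, h2, h3⟩ := log_mod_spec h0
  generalize Nat.log 2 _ = t at *
  have h4 := (h.bits _ _).1 h2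
  have h5 := blk_mul_add (x := blk n e) h4.1
  rw [← hu] at h4 h5
  have h6 := blk_mul_add_mod n e
  have h7 := blk_mul_add_mod n u
  rw [h5] at h7
  refine ⟨by omega, h4.2, by omega, h5, fun e' he' hle hb => ?_⟩
  have h8 := h3 (e' % blockSize n) ((blk_eq_le_iff hb.symm).2 hle) (hb ▸ (h.testBit_iff e').2 he')
  have h9 := blk_mul_add_mod n e'
  rw [hb] at h9
  omega

theorem mul_add_eq_iff {u x i : ℕ} (hi : i < blockSize n) :
    x * blockSize n + i = u ↔ x = blk n u ∧ i = u % blockSize n := by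
  constructor
  · rintro rfl
    refine ⟨(blk_mul_add hi).symm, ?_⟩
    rw [Nat.mul_add_mod_of_lt hi]
  · rintro ⟨rfl, rfl⟩
    exact blk_mul_add_mod n u

theorem Stair.erase (h : Stair n mask val F) {u : ℕ} (hu : u ∈ F) :
    Stair n (Function.update mask (blk n u) (mask (blk n u) - 2 ^ (u % blockSize n))) val
      (F.erase u) := by
  refine ⟨fun x i => ?_, fun e he e' he' => h.mono e (Finset.mem_of_mem_erase he) e'
    (Finset.mem_of_mem_erase he')⟩
  have hb := (h.testBit_iff u).2 hu
  rw [Finset.mem_erase]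
  by_cases hi : i < blockSize n
  · rw [Ne, mul_add_eq_iff hi]
    rcases eq_or_ne x (blk n u) with rfl | hx
    · rw [Function.update_self, testBit_sub_two_pow hb, Bool.and_eq_true, h.bits, decide_eq_true_eq]
      tauto
    · rw [Function.update_of_ne hx, h.bits]
      tauto
  · rcases eq_or_ne x (blk n u) with rfl | hx
    · rw [Function.update_self, testBit_sub_two_pow hb, Bool.and_eq_true, h.bits, decide_eq_true_eq]
      tauto
    · rw [Function.update_of_ne hx, h.bits]
      tauto

theorem Stair.insert (h : Stair n mask val F) {u : ℕ} {z : WithTop α} (hu : u ∉ F)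
    (hlt : ∀ e ∈ F, blk n e = blk n u → e < u → val e < z)
    (hgt : ∀ e ∈ F, blk n e = blk n u → u < e → z < val e) :
    Stair n (Function.update mask (blk n u) (mask (blk n u) + 2 ^ (u % blockSize n)))
      (Function.update val u z) (insert u F) := by
  refine ⟨fun x i => ?_, fun e he e' he' hb hee => ?_⟩
  · have hb : (mask (blk n u)).testBit (u % blockSize n) = false := by
      rw [Bool.eq_false_iff]
      exact fun hb => hu ((h.testBit_iff u).1 hb)
    rw [Finset.mem_insert]
    have hlt := Nat.mod_lt u (blockSize_pos n)
    by_cases hi : i < blockSize n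
    · rw [mul_add_eq_iff hi]
      rcases eq_or_ne x (blk n u) with rfl | hx
      · rw [Function.update_self, testBit_add_two_pow hb, Bool.or_eq_true, h.bits,
          decide_eq_true_eq]
        tauto
      · rw [Function.update_of_ne hx, h.bits]
        tauto
    · have hne : i ≠ u % blockSize n := by omega
      rcases eq_or_ne x (blk n u) with rfl | hx
      · rw [Function.update_self, testBit_add_two_pow hb, Bool.or_eq_true, h.bits,
          decide_eq_true_eq]
        tauto
      · rw [Function.update_of_ne hx, h.bits]
        tauto
  · rw [Finset.mem_insert] at he he'
    rcases he with rfl | he <;> rcases he' with rfl | he'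
    · omega
    · rw [Function.update_self, Function.update_of_ne (by omega)]
      exact hgt e' he' hb.symm hee
    · rw [Function.update_self, Function.update_of_ne (by omega)]
      exact hlt e he hb hee
    · rw [Function.update_of_ne (show e ≠ u from fun hh => hu (hh ▸ he)),
        Function.update_of_ne (show e' ≠ u from fun hh => hu (hh ▸ he'))]
      exact h.mono e he e' he' hb hee

theorem StairLe.insert_iff {u y : ℕ} {z t : WithTop α} (hu : u ∉ F) :
    StairLe n (Function.update val u t) (insert u F) y z ↔
      StairLe n val F y z ∧ (y ≤ u → blk n u = blk n y → z ≤ t) := by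
  have hne : ∀ e ∈ F, Function.update val u t e = val e := fun e he =>
    Function.update_of_ne (show e ≠ u from fun hh => hu (hh ▸ he)) _ _
  constructor
  · intro H
    refine ⟨fun e he hy hb => ?_, fun hy hb => ?_⟩
    · simpa [hne e he] using H e (Finset.mem_insert_of_mem he) hy hb
    · simpa using H u (Finset.mem_insert_self _ _) hy hb
  · rintro ⟨H1, H2⟩ e he hy hb
    rcases Finset.mem_insert.1 he with rfl | he'
    · simpa using H2 hy hb
    · simpa [hne e he'] using H1 e he' hy hb

/-- A step at row `u` may be removed in favour of a new step with a smaller value at a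
later row `e` of the same block. -/
theorem StairLe.erase_iff {u e y : ℕ} {z t : WithTop α} (hue : u ≤ e)
    (hb : blk n u = blk n e) (ht : t ≤ val u) :
    (StairLe n val (F.erase u) y z ∧ (y ≤ e → blk n e = blk n y → z ≤ t)) ↔
      (StairLe n val F y z ∧ (y ≤ e → blk n e = blk n y → z ≤ t)) := by
  refine and_congr_left fun H => ⟨fun H1 x hx hy hxb => ?_, fun H1 x hx =>
    H1 x (Finset.mem_of_mem_erase hx)⟩
  rcases eq_or_ne x u with rfl | hne
  · exact (H (hy.trans hue) (hb.symm.trans hxb)).trans ht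
  · exact H1 x (Finset.mem_erase.2 ⟨hne, hx⟩) hy hxb

end Stair

end

/-! ### Inserting an interval into a staircase -/

section

/-- Load the mask of the steps at or before the row whose block and position in the block are in
registers `8` and `9`: the remainder of the mask modulo a power of two. -/
def loadLowerBits : Prog :=
  .setReg 10 (.cell 8 (.reg 8) -ʷ .cell 8 (.reg 8) /ʷ .cell 5 (.reg 9 +ʷ .const 1) *ʷ
    .cell 5 (.reg 9 +ʷ .const 1))

/-- Remove the last one of the steps loaded by `loadLowerBits`. -/
def popStep : Prog :=
  .setArr 8 (.reg 8) (.cell 8 (.reg 8) -ʷ .cell 5 (.cell 3 (.reg 10))) ;; loadLowerBits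

/-- The last loaded step exists and its value is not below the value of the interval in register
`12`.  Conjunctions evaluate both parts; if there is no step, the second part reads some cell, and
its outcome does not matter. -/
def popTest : Test :=
  .and (.not (.eq (.reg 10) (.const 0)))
    (.not (.entLt (.cell 5 (.reg 8 *ʷ .reg 3 +ʷ .cell 3 (.reg 10))) (.cell 0 (.reg 12))))

/-- Insert the interval in register `12`, unless the first step at or after its last row has a value
that is not larger.  Otherwise all steps at or before its last row whose values are not smaller are
removed, and a new step is added at its last row. -/
def insertStep : Prog :=
  (.setReg 7 (.cell 2 (.reg 12)) ;;
   .setReg 8 (.reg 7 /ʷ .reg 3) ;;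
   .setReg 9 (.reg 7 -ʷ .reg 8 *ʷ .reg 3) ;;
   .setReg 10 (.cell 8 (.reg 8) /ʷ .cell 5 (.reg 9))) ;;
  .ite (.and (.not (.eq (.reg 10) (.const 0)))
      (.not (.entLt (.cell 0 (.reg 12)) (.cell 5 (.reg 7 +ʷ .cell 4 (.reg 10))))))
    .skip
    (loadLowerBits ;;
     .while popTest popStep ;;
     .setArr 8 (.reg 8) (.cell 8 (.reg 8) +ʷ .cell 5 (.reg 9)) ;;
     .setEnt 5 (.reg 7) (.cell 0 (.reg 12)))

variable {α : Type*} [LinearOrder α]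

/-- The loop removes all steps of the block at or before row `e` with a value of at least `t`.  Each
removal is paid for by the decrease of the number of steps. -/
theorem pop_spec {w n N T₀ T e : ℕ} {a b : ℕ → ℕ} {v : ℕ → WithTop α} {t : WithTop α}
    {s : State α} {F : Finset ℕ}
    (hw : N + 4 * (n + 3) ^ 2 < 2 ^ w) (he : e ≤ n) (hs : Setting n N a b v s)
    (hF : Stair n (s.arr 8) (s.ent 5) F)
    (hgt : ∀ u ∈ F, blk n u = blk n e → e ≤ u → t < s.ent 5 u)
    (h8 : s.reg 8 = blk n e) (h9 : s.reg 9 = e % blockSize n)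
    (h10 : s.reg 10 = s.arr 8 (blk n e) % 2 ^ (e % blockSize n + 1))
    (h12 : s.reg 12 < N) (ht : v (s.reg 12) = t)
    (hT : T₀ + 100 * F.card + 50 ≤ T) :
    Wp w (.while popTest popStep) (fun s' T' => ∃ F' : Finset ℕ,
      Stair n (s'.arr 8) (s'.ent 5) F' ∧
      (∀ u ∈ F', blk n u = blk n e → e ≤ u → t < s.ent 5 u) ∧
      (∀ u ∈ F', blk n u = blk n e → u ≤ e → s.ent 5 u < t) ∧
      (∀ y z, (StairLe n (s.ent 5) F' y z ∧ (y ≤ e → blk n e = blk n y → z ≤ t)) ↔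
        (StairLe n (s.ent 5) F y z ∧ (y ≤ e → blk n e = blk n y → z ≤ t))) ∧
      T₀ + 100 * F'.card ≤ T') s T := by
  have hw' : N + (4 * n + 30) < 2 ^ w := by nlinarith
  have hw0 : w ≠ 0 := by rintro rfl; simp at hw'
  refine .loop (fun s' T' => ∃ F' : Finset ℕ,
      Stair n (s'.arr 8) (s'.ent 5) F' ∧
      s'.reg 10 = s'.arr 8 (blk n e) % 2 ^ (e % blockSize n + 1) ∧
      (∀ u ∈ F', blk n u = blk n e → e ≤ u → t < s.ent 5 u) ∧
      (∀ y z, (StairLe n (s.ent 5) F' y z ∧ (y ≤ e → blk n e = blk n y → z ≤ t)) ↔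
        (StairLe n (s.ent 5) F y z ∧ (y ≤ e → blk n e = blk n y → z ≤ t))) ∧
      T₀ + 100 * F'.card + 50 ≤ T') ⟨F, hF, h10, hgt, fun _ _ => Iff.rfl, hT⟩ ?_
  rintro s' T' hfr ⟨F', hF', hd, hgt', hle, hT'⟩
  have hs' : Setting n N a b v s' := hs.of_frame hfr (by decide) (by decide) (by decide)
  have r8 := hfr.reg 8 (by decide)
  have r9 := hfr.reg 9 (by decide)
  have r12 := hfr.reg 12 (by decide)
  have e5 := hfr.ent 5 (by decide)
  rw [h8] at r8
  rw [h9] at r9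
  rw [← r12] at h12 ht
  have hB2 := two_pow_blockSize_le n
  have hm := hF'.mask_lt (blk n e)
  have hdm : s'.reg 10 ≤ s'.arr 8 (blk n e) := hd ▸ Nat.mod_le _ _
  have hdl : s'.arr 3 (s'.reg 10) = Nat.log 2 (s'.reg 10) := hs'.log _ (by omega)
  have hll := Nat.log_le_self 2 (s'.reg 10)
  have hbl := blk_mul_add_mod n e
  have hble := blk_le n e
  have hpc : popTest.cost = 16 := rfl
  have hB := blockSize_le n
  refine ⟨?_, ?_, ?_, ?_⟩
  · simp [popTest, r8, hs'.reg3, hdl]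
    omega
  · omega
  · intro hv
    simp [popTest, r8, hs'.reg3, hdl, hs'.value, ht] at hv
    obtain ⟨h0, hv⟩ := hv
    obtain ⟨hu1, hu2, hu3, hu4, hu5⟩ := hF'.pred hd h0 rfl
    generalize huu : blk n e * blockSize n + Nat.log 2 (s'.reg 10) = u at *
    have hj := Nat.mod_lt e (blockSize_pos n)
    have hj' := Nat.mod_lt u (blockSize_pos n)
    have hp1 := hs'.pow (e % blockSize n + 1) hj
    have hp2 := hs'.pow (u % blockSize n) hj'.le
    have hple := (Nat.pow_le_pow_right (show 0 < 2 by norm_num) hj).trans hB2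
    have hple' := (Nat.pow_le_pow_right (show 0 < 2 by norm_num) hj'.le).trans hB2
    have herase := hF'.erase hu2
    rw [hu4] at herase
    have hcard := Finset.card_erase_add_one hu2
    refine .of_vc (by simp [popStep, loadLowerBits]; omega) ?_
    simp [popStep, loadLowerBits, hw0, r8, r9, hdl, hu1, hp1, hp2]
    have hmul := Nat.div_mul_le_self (s'.arr 8 (blk n e) - 2 ^ (u % blockSize n))
      (2 ^ (e % blockSize n + 1))
    have hmod := Nat.mod_eq_sub_div_mul
      (x := s'.arr 8 (blk n e) - 2 ^ (u % blockSize n)) (k := 2 ^ (e % blockSize n + 1))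
    have hsub := Nat.sub_le (s'.arr 8 (blk n e)) (2 ^ (u % blockSize n))
    constructorm* _ ∧ _
    all_goals try omega
    refine ⟨F'.erase u, herase, hmod.symm, fun x hx => hgt' x (Finset.mem_of_mem_erase hx), ?_, ?_⟩
    · intro y z
      exact and_congr_left_iff.1 ((StairLe.erase_iff hu3 hu4 (e5 ▸ hv)).trans (hle y z))
    · omega
  · intro hv
    simp [popTest, r8, hs'.reg3, hdl, hs'.value, ht] at hv
    refine ⟨F', hF', hgt', ?_, hle, by omega⟩
    intro u hu hub hue
    by_cases h0 : s'.reg 10 = 0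
    · exact absurd hub (hF'.no_pred (hd ▸ h0) u hu hue)
    · obtain ⟨hu1, hu2, hu3, hu4, hu5⟩ := hF'.pred hd h0 rfl
      have h1 := hv h0
      generalize huu : blk n e * blockSize n + Nat.log 2 (s'.reg 10) = u' at *
      rw [e5] at h1
      rcases (hu5 u hu hue hub).eq_or_lt with rfl | hlt
      · exact h1
      · exact (e5 ▸ hF'.mono u hu u' hu2 (hub.trans hu4.symm) hlt).trans h1

/-- An insertion takes constant time, apart from the removals; the constant also pays for the new
step. -/
theorem insertStep_spec {w n N T₀ T q : ℕ} {a b : ℕ → ℕ} {v : ℕ → WithTop α}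
    {s : State α} {F : Finset ℕ}
    (hw : N + 4 * (n + 3) ^ 2 < 2 ^ w) (hs : Setting n N a b v s)
    (hF : Stair n (s.arr 8) (s.ent 5) F) (h12 : s.reg 12 = q) (hq : q < N) (hb : b q ≤ n)
    (hT : T₀ + 100 * F.card + 300 ≤ T) :
    Wp w insertStep (fun s' T' => ∃ F' : Finset ℕ,
      Stair n (s'.arr 8) (s'.ent 5) F' ∧
      (∀ y z, StairLe n (s'.ent 5) F' y z ↔
        (StairLe n (s.ent 5) F y z ∧ (y ≤ b q → blk n (b q) = blk n y → z ≤ v q))) ∧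
      T₀ + 100 * F'.card ≤ T') s T := by
  have hw' : N + (4 * n + 30) < 2 ^ w := by nlinarith
  have hw0 : w ≠ 0 := by rintro rfl; simp at hw'
  obtain ⟨e, he⟩ : ∃ e, b q = e := ⟨_, rfl⟩
  rw [he] at hb ⊢
  have hB := blockSize_le n
  have hB0 := blockSize_pos n
  have e1 : e / blockSize n = blk n e := rfl
  have hbl := blk_mul_add_mod n e
  have hj := Nat.mod_lt e (blockSize_pos n)
  have hle := blk_le n e
  have e2 : e - blk n e * blockSize n = e % blockSize n := by omega
  have hB2 := two_pow_blockSize_le n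
  have hm := hF.mask_lt (blk n e)
  have hp := hs.pow (e % blockSize n) hj.le
  have hp1 := hs.pow (e % blockSize n + 1) hj
  have hple := (Nat.pow_le_pow_right (show 0 < 2 by norm_num) hj.le).trans hB2
  have hple' := (Nat.pow_le_pow_right (show 0 < 2 by norm_num) hj).trans hB2
  have hp0 : 0 < 2 ^ (e % blockSize n) := by positivity
  refine .seq (.of_vc (by simp; omega) ?_)
  simp [h12, hs.last, he, hs.reg3, e1, e2, hp]
  constructorm* _ ∧ _ <;> try omega
  obtain ⟨d, hd⟩ : ∃ d, d = s.arr 8 (blk n e) / 2 ^ (e % blockSize n) := ⟨_, rfl⟩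
  have hdle : d ≤ s.arr 8 (blk n e) := hd ▸ Nat.div_le_self _ _
  have hlow := hs.low d (by omega)
  have hll : lowBit d ≤ d := (lowBit_le d).trans (Nat.log_le_self _ _)
  rw [← hd]
  have hs4 : Setting n N a b v ((((s.writeReg 7 e).writeReg 8 (blk n e)).writeReg 9
      (e % blockSize n)).writeReg 10 d) :=
    (((hs.writeReg (by norm_num) _).writeReg (by norm_num) _).writeReg (by norm_num) _).writeReg
      (by norm_num) _
  refine .ite ?_ (by simp; omega) ?_ ?_
  · simp [h12, hlow]; omega
  · intro hv
    simp [h12, hlow, hs.value] at hv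
    obtain ⟨hs1, hs2, -⟩ := hF.succ hd hv.1
    refine .of_vc (by simp; omega) ?_
    simp
    refine ⟨F, hF, fun y z => ⟨fun H => ⟨H, fun h1 h2 => ?_⟩, fun H => H.1⟩, by omega⟩
    exact (H _ hs1 (by omega) (hs2.trans h2)).trans hv.2
  · intro hv
    simp [h12, hlow, hs.value] at hv
    have hgt : ∀ u ∈ F, blk n u = blk n e → e ≤ u → v q < s.ent 5 u := by
      intro u hu hub hue
      by_cases h0 : d = 0
      · exact absurd hub (hF.no_succ (hd ▸ h0) u hu hue)
      · obtain ⟨hs1, hs2, hs3⟩ := hF.succ hd h0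
        rcases (hs3 u hu hue hub).eq_or_lt with rfl | hlt
        · exact hv h0
        · exact (hv h0).trans (hF.mono _ hs1 u hu (hs2.trans hub.symm) hlt)
    refine .seq (.of_vc (by simp [loadLowerBits]; omega) ?_)
    have hmul := Nat.div_mul_le_self (s.arr 8 (blk n e)) (2 ^ (e % blockSize n + 1))
    simp [loadLowerBits, hw0, hp1]
    refine ⟨by omega, ?_⟩
    refine Wp.seq_frame (pop_spec (T₀ := T₀ + 150) (e := e) hw hb (hs4.writeReg (by norm_num) _)
      hF hgt ?_ ?_ ?_ ?_ ?_ ?_) ?_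
    · simp
    · simp
    · simp [Nat.mod_eq_sub_div_mul]
    · simpa [h12] using hq
    · simp [h12]
    · omega
    rintro s' T' hfr ⟨F', hF', hgt', hlt', hle', hT'⟩
    have hs' : Setting n N a b v s' :=
      (hs4.writeReg (by norm_num) _).of_frame hfr (by decide) (by decide) (by decide)
    have r7 := hfr.reg 7 (by decide)
    have r8 := hfr.reg 8 (by decide)
    have r9 := hfr.reg 9 (by decide)
    have r12 := hfr.reg 12 (by decide)
    have e5 := hfr.ent 5 (by decide)
    simp [h12] at r7 r8 r9 r12 e5 hgt' hlt'
    have hm' := hF'.mask_lt (blk n e)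
    -- A step at `e` itself has either prevented the insertion or been removed.
    have hnot : e ∉ F' := fun hmem =>
      lt_asymm (hgt' e hmem rfl le_rfl) (hlt' e hmem rfl le_rfl)
    refine .of_vc (by simp; omega) ?_
    simp [r7, r8, r9, r12, hs'.pow _ hj.le, hs'.value]
    constructorm* _ ∧ _ <;> try omega
    refine ⟨insert e F', hF'.insert hnot ?_ ?_, ?_, ?_⟩
    · intro u hu hub hue
      rw [e5]
      exact hlt' u hu hub hue.le
    · intro u hu hub hue
      rw [e5]
      exact hgt' u hu hub hue.le
    · intro y z
      rw [StairLe.insert_iff hnot, e5]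
      exact hle' y z
    · rw [Finset.card_insert_of_notMem hnot]
      omega

end

/-! ### The sweep over the rows -/

section

/-- Insert all intervals that start in row `r` (register `5`) and lie within one block. -/
def insertAll : Prog :=
  .setReg 6 (.cell 6 (.reg 5)) ;;
  .while (.not (.eq (.reg 6) (.const 0)))
    (.setReg 12 (.reg 6 -ʷ .const 1) ;; insertStep ;; .setReg 6 (.cell 7 (.reg 12)))

/-- Output the minimum of row `r` (register `5`): of the staircase at `r`, of the value for the block
of `r`, and of the running minima at `r`. -/
def query : Prog :=
  .setReg 7 (.reg 5 /ʷ .reg 3) ;;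
  .setReg 8 (.cell 8 (.reg 7) /ʷ .cell 5 (.reg 5 -ʷ .reg 7 *ʷ .reg 3)) ;;
  .ite (.eq (.reg 8) (.const 0))
    (.setEnt 1 (.reg 5) .top)
    (.setEnt 1 (.reg 5) (.cell 5 (.reg 5 +ʷ .cell 4 (.reg 8)))) ;;
  minInto 1 (.reg 5) 2 (.reg 7) ;;
  minInto 1 (.reg 5) 3 (.reg 5) ;;
  minInto 1 (.reg 5) 4 (.reg 5) ;;
  .setReg 5 (.reg 5 +ʷ .const 1)

/-- Process the rows one after another. -/
def sweep : Prog :=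
  .setReg 5 (.const 0) ;;
  .while (.lt (.reg 5) (.reg 0 +ʷ .const 1)) (insertAll ;; query)

variable {α : Type*} [LinearOrder α]

theorem insertAll_spec {w n N T₀ T r : ℕ} {a b : ℕ → ℕ} {v : ℕ → WithTop α}
    {s : State α} {F : Finset ℕ} {l : List ℕ}
    (hw : N + 4 * (n + 3) ^ 2 < 2 ^ w) (hs : Setting n N a b v s)
    (hF : Stair n (s.arr 8) (s.ent 5) F) (hr : s.reg 5 = r) (hrn : r ≤ n)
    (hl : Linked (s.arr 7) (s.arr 6 r) l) (hmem : ∀ q ∈ l, q < N ∧ b q ≤ n)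
    (hT : T₀ + 100 * F.card + 400 * l.length + 50 ≤ T) :
    Wp w insertAll (fun s' T' => ∃ F' : Finset ℕ,
      Stair n (s'.arr 8) (s'.ent 5) F' ∧
      (∀ y z, StairLe n (s'.ent 5) F' y z ↔ (StairLe n (s.ent 5) F y z ∧
        ∀ q ∈ l, y ≤ b q → blk n (b q) = blk n y → z ≤ v q)) ∧
      T₀ + 100 * F'.card ≤ T') s T := by
  have hw' : N + (4 * n + 30) < 2 ^ w := by nlinarith
  have hw0 : w ≠ 0 := by rintro rfl; simp at hw'
  have hlink : ∀ {f : ℕ → ℕ} {h : ℕ} {l : List ℕ}, Linked f h l → (∀ q ∈ l, q < N ∧ b q ≤ n) →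
      h ≤ N := by
    intro f h l hh hm
    cases l with
    | nil => rw [show h = 0 from hh]; omega
    | cons q l => have := (hm q (by simp)).1; rw [hh.1]; omega
  have h0 := hlink hl hmem
  refine .seq (.of_vc (by simp; omega) ?_)
  simp [hr]
  constructorm* _ ∧ _ <;> try omega
  refine .loop (fun s' T' => ∃ (F' : Finset ℕ) (l' : List ℕ),
      Stair n (s'.arr 8) (s'.ent 5) F' ∧
      Linked (s'.arr 7) (s'.reg 6) l' ∧ (∀ q ∈ l', q < N ∧ b q ≤ n) ∧
      (∀ y z, (StairLe n (s'.ent 5) F' y z ∧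
          ∀ q ∈ l', y ≤ b q → blk n (b q) = blk n y → z ≤ v q) ↔
        (StairLe n (s.ent 5) F y z ∧ ∀ q ∈ l, y ≤ b q → blk n (b q) = blk n y → z ≤ v q)) ∧
      T₀ + 100 * F'.card + 400 * l'.length + 10 ≤ T')
    ⟨F, l, hF, hl, hmem, fun _ _ => Iff.rfl, by omega⟩ ?_
  rintro s' T' hfr ⟨F', l', hF', hl', hmem', hle, hT'⟩
  have hs' : Setting n N a b v s' :=
    (hs.writeReg (by norm_num) _).of_frame hfr (by decide) (by decide) (by decide)
  have h6 := hlink hl' hmem'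
  refine ⟨?_, ?_, ?_, ?_⟩
  · simp; omega
  · simp; omega
  · intro hv
    simp at hv
    cases l' with
    | nil => exact absurd hl' hv
    | cons q l' =>
      obtain ⟨hq, hl'⟩ := hl'
      obtain ⟨hqN, hqb⟩ := hmem' q (by simp)
      have hnext := hlink hl' fun q' hq' => hmem' q' (by simp [hq'])
      rw [List.length_cons] at hT'
      have hbudget : T₀ + 400 * l'.length + 40 + 100 * F'.card + 300 ≤ T' - 5 - 4 :=
        Nat.le_sub_of_add_le (Nat.le_sub_of_add_le (by linarith))
      refine .seq (.of_vc (by simp; omega) ?_)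
      simp [hq, hw0]
      refine ⟨by omega, Wp.seq_frame (insertStep_spec (q := q) (F := F')
        (T₀ := T₀ + 400 * l'.length + 40) hw (hs'.writeReg (by norm_num) _)
        hF' (by simp) hqN hqb ?_) ?_⟩
      · exact hbudget
      rintro s₂ T₂ hfr₂ ⟨F₂, hF₂, hle₂, hT₂⟩
      have r12 := hfr₂.reg 12 (by decide)
      have a7 := hfr₂.arr 7 (by decide)
      simp at r12 a7
      refine .of_vc (by simp; omega) ?_
      simp [r12, a7]
      constructorm* _ ∧ _ <;> try omega
      refine ⟨F₂, hF₂, l', hl', fun q' hq' => hmem' q' (by simp [hq']), fun y z => ?_, by omega⟩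
      have h1 := hle₂ y z
      have h2 := hle y z
      simp only [List.forall_mem_cons, State.writeReg_ent] at h1 h2
      have h3 := (and_congr_left' h1).trans (and_assoc.trans h2)
      simpa using h3
  · intro hv
    simp at hv
    cases l' with
    | nil =>
      refine ⟨F', hF', fun y z => ?_, by simp at hT' ⊢; omega⟩
      rw [← hle y z]
      simp
    | cons q l' =>
      have := hl'.1
      omega

theorem query_spec {w n N T₀ T r : ℕ} {a b : ℕ → ℕ} {v : ℕ → WithTop α}
    {s : State α} {F : Finset ℕ}
    (hw : N + 4 * (n + 3) ^ 2 < 2 ^ w) (hs : Setting n N a b v s)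
    (hF : Stair n (s.arr 8) (s.ent 5) F) (hr : s.reg 5 = r) (hrn : r ≤ n)
    (hT : T₀ + 100 ≤ T) :
    Wp w query (fun s' T' => s'.reg 5 = r + 1 ∧ (∀ y ≠ r, s'.ent 1 y = s.ent 1 y) ∧
      (∀ z, z ≤ s'.ent 1 r ↔ StairLe n (s.ent 5) F r z ∧ z ≤ s.ent 2 (blk n r) ∧
        z ≤ s.ent 3 r ∧ z ≤ s.ent 4 r) ∧
      T₀ ≤ T') s T := by
  have hw' : N + (4 * n + 30) < 2 ^ w := by nlinarith
  have hw0 : w ≠ 0 := by rintro rfl; simp at hw'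
  have hB := blockSize_le n
  have hB0 := blockSize_pos n
  have e1 : r / blockSize n = blk n r := rfl
  have hbl := blk_mul_add_mod n r
  have hj := Nat.mod_lt r (blockSize_pos n)
  have hle := blk_le n r
  have e2 : r - blk n r * blockSize n = r % blockSize n := by omega
  have hB2 := two_pow_blockSize_le n
  have hm := hF.mask_lt (blk n r)
  have hp := hs.pow (r % blockSize n) hj.le
  have hple := (Nat.pow_le_pow_right (show 0 < 2 by norm_num) hj.le).trans hB2
  have hp0 : 0 < 2 ^ (r % blockSize n) := by positivity
  refine .of_vc (by simp [query]; omega) ?_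
  obtain ⟨d, hd⟩ : ∃ d, d = s.arr 8 (blk n r) / 2 ^ (r % blockSize n) := ⟨_, rfl⟩
  have hdle : d ≤ s.arr 8 (blk n r) := hd ▸ Nat.div_le_self _ _
  have hlow := hs.low d (by omega)
  have hll : lowBit d ≤ d := (lowBit_le d).trans (Nat.log_le_self _ _)
  simp [query, hw0, hr, hs.reg3, e1, e2, hp, ← hd, hlow]
  constructorm* _ ∧ _ <;> try omega
  · intro h0
    constructorm* _ ∧ _ <;> try omega
    · exact fun y hy => by simp [hy]
    · intro z
      have : StairLe n (s.ent 5) F r z := fun e he hre hb =>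
        absurd hb (hF.no_succ (hd ▸ h0) e he hre)
      simp [this, and_assoc]
  · intro h0
    constructorm* _ ∧ _ <;> try omega
    · exact fun y hy => by simp [hy]
    · intro z
      obtain ⟨h1, h2, h3⟩ := hF.succ hd h0
      -- As the values increase, the first step at or after `r` has the least value.
      have : StairLe n (s.ent 5) F r z ↔ z ≤ s.ent 5 (r + lowBit d) := by
        refine ⟨fun H => H _ h1 (by omega) h2, fun H e he hre hb => ?_⟩
        rcases (h3 e he hre hb).eq_or_lt with rfl | hlt
        · exact H
        · exact H.trans (hF.mono _ h1 e he (h2.trans hb.symm) hlt).le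
      simp [this, and_assoc]

theorem sweep_spec {w n N T₀ T : ℕ} {a b : ℕ → ℕ} {v : ℕ → WithTop α} {s : State α}
    (hw : N + 4 * (n + 3) ^ 2 < 2 ^ w) (hab : ∀ q < N, a q ≤ n + 1 ∧ b q ≤ n)
    (hs : Setting n N a b v s)
    (h8 : ∀ x, s.arr 8 x = 0) (hl : ∀ y, Linked (s.arr 7) (s.arr 6 y) (bucket n a b y N))
    (hT : T₀ + 600 * (n + N + 2) ≤ T) :
    Wp w sweep (fun s' T' => (∀ r ≤ n, ∀ z, z ≤ s'.ent 1 r ↔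
      (∀ q < N, a q ≤ r → r ≤ b q → blk n (a q) = blk n (b q) → z ≤ v q) ∧
        z ≤ s.ent 2 (blk n r) ∧ z ≤ s.ent 3 r ∧ z ≤ s.ent 4 r) ∧ T₀ ≤ T') s T := by
  have hw' : N + (4 * n + 30) < 2 ^ w := by nlinarith
  have hw0 : w ≠ 0 := by rintro rfl; simp at hw'
  have hsum := sum_length_bucket_le n a b (Finset.Ico 0 (n + 1)) N
  refine .seq (.of_vc (by simp; omega) ?_)
  simp
  refine .loop (fun s' T' => ∃ F : Finset ℕ, s'.reg 5 ≤ n + 1 ∧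
    Stair n (s'.arr 8) (s'.ent 5) F ∧
    (∀ y z, StairLe n (s'.ent 5) F y z ↔ ∀ q < N, a q ≤ b q → blk n (a q) = blk n (b q) →
      a q < s'.reg 5 → y ≤ b q → blk n (b q) = blk n y → z ≤ v q) ∧
    (∀ r < s'.reg 5, ∀ z, z ≤ s'.ent 1 r ↔
      (∀ q < N, a q ≤ r → r ≤ b q → blk n (a q) = blk n (b q) → z ≤ v q) ∧
        z ≤ s.ent 2 (blk n r) ∧ z ≤ s.ent 3 r ∧ z ≤ s.ent 4 r) ∧
    T₀ + 10 + 200 * (n + 1 - s'.reg 5) +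
      400 * ∑ y ∈ Finset.Ico (s'.reg 5) (n + 1), (bucket n a b y N).length + 100 * F.card ≤ T') ?_ ?_
  · refine ⟨∅, by simp, ⟨fun x i => by simp [h8], by simp⟩, by simp [StairLe], by simp, ?_⟩
    simp only [State.writeReg_reg, if_true, Finset.card_empty]
    omega
  rintro s' T' hfr ⟨F, hr, hF, hle, hout, hT'⟩
  have hs' : Setting n N a b v s' :=
    (hs.writeReg le_rfl _).of_frame hfr (by decide) (by decide) (by decide)
  have a6 := hfr.arr 6 (by decide)
  have a7 := hfr.arr 7 (by decide)
  have e2 := hfr.ent 2 (by decide)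
  have e3 := hfr.ent 3 (by decide)
  have e4 := hfr.ent 4 (by decide)
  simp at a6 a7 e2 e3 e4
  generalize hx : s'.reg 5 = r at *
  refine ⟨?_, ?_, ?_, ?_⟩
  · simp [hx, hs'.reg0]; omega
  · simp; omega
  · intro hv
    simp [hx, hs'.reg0] at hv
    rw [Finset.sum_eq_sum_Ico_succ_bot (by omega)] at hT'
    refine Wp.seq_frame (insertAll_spec
      (T₀ := T₀ + 120 + 200 * (n + 1 - (r + 1)) +
        400 * ∑ y ∈ Finset.Ico (r + 1) (n + 1), (bucket n a b y N).length)
      (F := F) (l := bucket n a b r N) hw hs' hF hx (by omega) (a6 ▸ a7 ▸ hl r) ?_ ?_) ?_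
    · exact fun q hq => ⟨(mem_bucket.1 hq).1, (hab q (mem_bucket.1 hq).1).2⟩
    · simp; omega
    rintro s₂ T₂ hfr₂ ⟨F₂, hF₂, hle₂, hT₂⟩
    have hs₂ : Setting n N a b v s₂ := hs'.of_frame hfr₂ (by decide) (by decide) (by decide)
    have r5 := hfr₂.reg 5 (by decide)
    have f1 := hfr₂.ent 1 (by decide)
    have f2 := hfr₂.ent 2 (by decide)
    have f3 := hfr₂.ent 3 (by decide)
    have f4 := hfr₂.ent 4 (by decide)
    rw [hx] at r5
    have hle₃ : ∀ y z, StairLe n (s₂.ent 5) F₂ y z ↔ ∀ q < N, a q ≤ b q →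
        blk n (a q) = blk n (b q) → a q < r + 1 → y ≤ b q → blk n (b q) = blk n y → z ≤ v q := by
      intro y z
      rw [hle₂, hle]
      constructor
      · rintro ⟨H1, H2⟩ q hq hab' hb hqr
        rcases Nat.lt_succ_iff_lt_or_eq.1 hqr with h | h
        · exact H1 q hq hab' hb h
        · exact H2 q (mem_bucket.2 ⟨hq, hab', hb, h⟩)
      · refine fun H => ⟨fun q hq hab' hb hqr => H q hq hab' hb (by omega), fun q hq => ?_⟩
        obtain ⟨h1, h2, h3, h4⟩ := mem_bucket.1 hq
        exact H q h1 h2 h3 (by omega)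
    refine ((query_spec (T₀ := T₂ - 100) hw hs₂ hF₂ r5 (by omega) (by omega)).frame).mono ?_
    rintro s₃ T₃ ⟨hfr₃, hr₃, hne₃, hout₃, hT₃⟩
    have g8 := hfr₃.arr 8 (by decide)
    have g5 := hfr₃.ent 5 (by decide)
    refine ⟨F₂, by omega, g8 ▸ g5 ▸ hF₂, ?_, ?_, ?_⟩
    · rw [g5, hr₃]
      exact hle₃
    · intro y hy z
      rw [hr₃] at hy
      rcases Nat.lt_succ_iff_lt_or_eq.1 hy with h | rfl
      · rw [hne₃ y (by omega), f1, hout y h]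
      · rw [hout₃, hle₃, f2, f3, f4, e2, e3, e4]
        refine and_congr_left fun _ => ⟨fun H q hq h1 h2 hb => ?_, fun H q hq h1 h2 h3 h4 h5 => ?_⟩
        · refine H q hq (h1.trans h2) hb (by omega) h2 (le_antisymm ?_ (blk_mono n h2))
          exact hb ▸ blk_mono n h1
        · exact H q hq (by omega) h4 h2
    · rw [hr₃]
      omega
  · intro hv
    simp [hx, hs'.reg0] at hv
    exact ⟨fun y hy => hout y (by omega), by simp; omega⟩

end

/-! ### The whole program -/

section

/-- The program that computes the row minima. -/
def rowMinimaProg : Prog :=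
  tables ;; scatter ;; pushDown ;; suffixMinima ;; prefixMinima ;; sweep

variable {α : Type*}

theorem offset_eq_length {m : ℕ} (R : Fin m → List (ColInterval α)) :
    offset R m = (allIntervals R).length := by
  rw [offset, List.take_of_length_le (by simp), allIntervals]

theorem length_allIntervals_le {k m : ℕ} {R : Fin m → List (ColInterval α)}
    (h : ∀ j, (R j).length ≤ k) : (allIntervals R).length ≤ m * k := by
  rw [allIntervals, List.length_flatten]
  refine (List.sum_le_card_nsmul _ k ?_).trans ?_
  · simpa using h
  · simp

theorem mem_allIntervals {m : ℕ} {R : Fin m → List (ColInterval α)} {I : ColInterval α} :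
    I ∈ allIntervals R ↔ ∃ j, I ∈ R j := by
  simp [allIntervals]

variable [LinearOrder α]

theorem le_rowMin_iff {n m k : ℕ} {M : Matrix (Fin n) (Fin m) (WithTop α)}
    {R : Fin m → List (ColInterval α)} (hR : IsConciseRep k M R) (i : Fin n) (z : WithTop α) :
    z ≤ rowMin M i ↔ ∀ I ∈ allIntervals R, I.first ≤ (i : ℕ) + 1 → (i : ℕ) + 1 ≤ I.last →
      z ≤ (I.value : WithTop α) := by
  simp only [rowMin, Finset.le_inf_iff, Finset.mem_univ, true_imp_iff, mem_allIntervals]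
  constructor
  · rintro H I ⟨j, hI⟩ h1 h2
    have := ((hR j).2.2 i I.value).2 ⟨I, hI, h1, h2, rfl⟩
    exact (H j).trans_eq this
  · intro H j
    cases h : M i j with
    | top => exact le_top
    | coe x =>
      obtain ⟨I, hI, h1, h2, rfl⟩ := ((hR j).2.2 i x).1 h
      exact H I ⟨j, hI⟩ h1 h2

/-- The minimum of a row is characterized by the intervals that contain the row. -/
theorem le_rowMin_iff_input {n m k : ℕ} {M : Matrix (Fin n) (Fin m) (WithTop α)}
    {R : Fin m → List (ColInterval α)} (hR : IsConciseRep k M R) (i : Fin n) (z : WithTop α) :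
    z ≤ rowMin M i ↔ ∀ q < (allIntervals R).length, (input n R).arr 1 q ≤ (i : ℕ) + 1 →
      (i : ℕ) + 1 ≤ (input n R).arr 2 q → z ≤ (input n R).ent 0 q := by
  rw [le_rowMin_iff hR, List.forall_mem_iff_forall_getElem]
  refine forall₂_congr fun q hq => ?_
  simp [input, hq]

theorem word_size_suffices {k n m w N : ℕ} (hN : N ≤ m * k)
    (hw : 2700 * (k + 1) * Nat.log 2 (n + m + 2) ≤ w) :
    N + 4 * (n + 3) ^ 2 < 2 ^ w ∧ m < 2 ^ w := by
  have h1 : 1 ≤ Nat.log 2 (n + m + 2) := Nat.log_pos (by norm_num) (by omega)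
  have h2 : n + m + 2 < 2 ^ (2 * Nat.log 2 (n + m + 2)) :=
    (Nat.lt_pow_succ_log_self (by norm_num) _).trans_le
      (Nat.pow_le_pow_right (by norm_num) (by omega))
  have h3 : k < 2 ^ k := Nat.lt_two_pow_self
  generalize Nat.log 2 (n + m + 2) = L at *
  -- `N ≤ 2 ^ k * 2 ^ (2 * L)` and `n + 3 ≤ 2 * 2 ^ (2 * L)` for `L = ⌊log₂ (n + m + 2)⌋`.
  have h4 : k + 5 + 4 * L ≤ w := by nlinarith
  have h5 : 2 ^ (k + 5 + 4 * L) ≤ 2 ^ w := Nat.pow_le_pow_right (by norm_num) h4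
  have h6 : 2 ^ (k + 5 + 4 * L) = 32 * 2 ^ k * (2 ^ (2 * L)) ^ 2 := by
    rw [← pow_mul, pow_add, pow_add]; ring
  rw [h6] at h5
  generalize 2 ^ (2 * L) = Y at *
  generalize 2 ^ k = K at *
  have h7 : m * k ≤ Y * K := Nat.mul_le_mul (by omega) h3.le
  have h8 : Y * K ≤ K * Y ^ 2 := by nlinarith [Nat.zero_le (K * Y)]
  have h9 : (n + 3) ^ 2 ≤ (2 * Y) ^ 2 := Nat.pow_le_pow_left (by omega) 2
  have h10 : Y ^ 2 ≤ K * Y ^ 2 := Nat.le_mul_of_pos_left _ (by omega)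
  have h11 : Y ≤ Y ^ 2 := Nat.le_self_pow (by norm_num) Y
  have h12 : 4 ≤ Y ^ 2 := by nlinarith
  constructor
  · have : (2 * Y) ^ 2 = 4 * Y ^ 2 := by ring
    have h13 : 32 * K * Y ^ 2 = 32 * (K * Y ^ 2) := by ring
    omega
  · have h13 : 32 * K * Y ^ 2 = 32 * (K * Y ^ 2) := by ring
    omega

/-- An interval that contains row `r` is accounted for by the staircase if it lies within one block,
by a running minimum if `r` is in its first or last block, and by the value of the block of `r`
otherwise. -/
theorem rowMinimaProg_spec {k n m w : ℕ} {M : Matrix (Fin n) (Fin m) (WithTop α)}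
    {R : Fin m → List (ColInterval α)} (hR : IsConciseRep k M R)
    (hw : (allIntervals R).length + 4 * (n + 3) ^ 2 < 2 ^ w) (hm : m < 2 ^ w) :
    Wp w rowMinimaProg (fun s _ => ∀ i : Fin n, s.ent 1 ((i : ℕ) + 1) = rowMin M i) (input n R)
      (2700 * (n + (allIntervals R).length + 1)) := by
  obtain ⟨N, hN⟩ : ∃ N, N = (allIntervals R).length := ⟨_, rfl⟩
  have hmin := le_rowMin_iff_input hR
  have hab : ∀ q < N, (input n R).arr 1 q ≤ n + 1 ∧ (input n R).arr 2 q ≤ n := by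
    intro q hq
    rw [hN] at hq
    obtain ⟨j, hj⟩ := mem_allIntervals.1 (List.getElem_mem hq)
    have := (hR j).2.1 _ hj
    simp [input, hq, this]
  rw [← hN] at hw hmin ⊢
  generalize ha : (input n R).arr 1 = a at *
  generalize hb : (input n R).arr 2 = b at *
  generalize hv : (input n R).ent 0 = v at *
  refine Wp.seq_frame (tables_spec (T₀ := 800 * N + 1100 * n + 2400) hw (n := n) ?_ ?_ ?_ ?_ ?_ ?_) ?_
  · simp [input]
  · simpa [input] using hm
  · simp [input, offset_eq_length, hN]
  · simp [input]
  · simp [input]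
  · omega
  rintro s₁ T₁ f₁ ⟨⟨ht, r2, r3, r4⟩, hT₁⟩
  have hs₁ : Setting n N a b v s₁ :=
    ⟨ht, by rw [f₁.reg 0 (by decide)]; simp [input], r2, r3, r4,
      by rw [f₁.arr 1 (by decide), ha], by rw [f₁.arr 2 (by decide), hb],
      by rw [f₁.ent 0 (by decide), hv]⟩
  have h0 : Scattered n a b v 0 (s₁.ent 3) (s₁.ent 4) (s₁.ent 2) (s₁.arr 6) (s₁.arr 7) := by
    rw [f₁.ent 3 (by decide), f₁.ent 4 (by decide), f₁.ent 2 (by decide), f₁.arr 6 (by decide)]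
    exact .zero
  refine Wp.seq_frame (scatter_spec (T₀ := 600 * N + 1100 * n + 2200) hw hab hs₁ h0
    (fun y => by rw [f₁.arr 6 (by decide)]; rfl) (by omega)) ?_
  rintro s₂ T₂ f₂ ⟨hsc, hT₂⟩
  have hs₂ : Setting n N a b v s₂ := hs₁.of_frame f₂ (by decide) (by decide) (by decide)
  refine Wp.seq_frame (pushDown_spec (T₀ := 600 * N + 800 * n + 1600) hw hs₂ (by linarith)) ?_
  rintro s₃ T₃ f₃ ⟨hmid, hT₃⟩
  have hs₃ : Setting n N a b v s₃ := hs₂.of_frame f₃ (by decide) (by decide) (by decide)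
  refine Wp.seq_frame (suffixMinima_spec (T₀ := 600 * N + 700 * n + 1400) hw hs₃ (by omega)) ?_
  rintro s₄ T₄ f₄ ⟨hsuf, hT₄⟩
  have hs₄ : Setting n N a b v s₄ := hs₃.of_frame f₄ (by decide) (by decide) (by decide)
  refine Wp.seq_frame (prefixMinima_spec (T₀ := 600 * N + 600 * n + 1200) hw hs₄ (by omega)) ?_
  rintro s₅ T₅ f₅ ⟨hpre, hT₅⟩
  have hs₅ : Setting n N a b v s₅ := hs₄.of_frame f₅ (by decide) (by decide) (by decide)
  refine (sweep_spec (T₀ := 0) hw hab hs₅ ?_ ?_ (by linarith)).mono ?_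
  · intro x
    rw [f₅.arr 8 (by decide), f₄.arr 8 (by decide), f₃.arr 8 (by decide), f₂.arr 8 (by decide),
      f₁.arr 8 (by decide)]
    rfl
  · intro y
    rw [f₅.arr 7 (by decide), f₄.arr 7 (by decide), f₃.arr 7 (by decide),
      f₅.arr 6 (by decide), f₄.arr 6 (by decide), f₃.arr 6 (by decide)]
    exact hsc.chain y
  rintro s₆ T₆ ⟨hout, -⟩ i
  refine eq_of_forall_le_iff fun z => ?_
  obtain ⟨r, hr⟩ : ∃ r, r = (i : ℕ) + 1 := ⟨_, rfl⟩
  have hrn : r ≤ n := by omega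
  rw [hmin, ← hr, hout r hrn, f₅.ent 2 (by decide), f₄.ent 2 (by decide), hmid _ (blk_lt hrn),
    hsc.mid, f₅.ent 3 (by decide), hsuf r hrn, f₃.ent 3 (by decide), hpre r hrn,
    f₄.ent 4 (by decide), f₃.ent 4 (by decide)]
  simp only [hsc.suf, hsc.pre]
  constructor
  · rintro ⟨H1, H2, H3, H4⟩ q hq haq hbq
    have m1 := blk_mono n haq
    have m2 := blk_mono n hbq
    by_cases hne : blk n (a q) = blk n (b q)
    · exact H1 q hq haq hbq hne
    have hc : a q ≤ b q ∧ blk n (a q) ≠ blk n (b q) := ⟨haq.trans hbq, hne⟩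
    by_cases hx : blk n (a q) = blk n r
    · exact H3 (a q) haq hx q hq hc rfl
    by_cases hy : blk n (b q) = blk n r
    · exact H4 (b q) (hab q hq).2 hbq hy q hq hc rfl
    · exact H2 q hq hc ⟨by omega, by omega⟩
  · intro H
    refine ⟨fun q hq h1 h2 _ => H q hq h1 h2, ?_, ?_, ?_⟩
    · intro q hq _ hlt
      have m1 : a q ≤ r := by
        by_contra h
        have := blk_mono n (show r ≤ a q by omega)
        omega
      have m2 : r ≤ b q := by
        by_contra h
        have := blk_mono n (show b q ≤ r by omega)
        omega
      exact H q hq m1 m2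
    · rintro x hx hxb q hq ⟨h1, h2⟩ rfl
      refine H q hq hx ?_
      by_contra h
      have m1 := blk_mono n h1
      have m2 := blk_mono n (show b q ≤ r by omega)
      omega
    · rintro x hxn hx hxb q hq ⟨h1, h2⟩ rfl
      refine H q hq ?_ hx
      by_contra h
      have m1 := blk_mono n h1
      have m2 := blk_mono n (show r ≤ a q by omega)
      omega

end

end RowMinima

/-- There is one program that, for every fixed `k`, computes the row minima of any concisely
represented `k`-concise `n × m` matrix within `O(n + m)` steps on words of any length
`w ≥ c · log₂ (n + m + 2)`; the minimum of row number `i` is left in cell `i` of entry array `1`.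
(The summand `1` in the time bound only serves the case `n = m = 0`.) -/
theorem lemma3 :
    ∃ P : RowMinima.Prog, ∀ k : ℕ, ∃ c : ℕ,
      ∀ (α : Type*) [LinearOrder α] (n m : ℕ) (M : Matrix (Fin n) (Fin m) (WithTop α))
        (R : Fin m → List (RowMinima.ColInterval α)) (w : ℕ),
        RowMinima.IsConcise k M → RowMinima.IsConciseRep k M R →
        c * Nat.log 2 (n + m + 2) ≤ w →
          ∃ (t : ℕ) (s : RowMinima.State α),
            RowMinima.Exec w P (RowMinima.input n R) t s ∧
            t ≤ c * (n + m + 1) ∧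
            ∀ i : Fin n, s.ent 1 ((i : ℕ) + 1) = RowMinima.rowMin M i := by
  refine ⟨RowMinima.rowMinimaProg, fun k => ⟨2700 * (k + 1), ?_⟩⟩
  intro α _ n m M R w _ hR hw
  have hN := RowMinima.length_allIntervals_le fun j => (hR j).1
  obtain ⟨h1, h2⟩ := RowMinima.word_size_suffices hN hw
  obtain ⟨t, s, T', hexec, ht, hs⟩ := RowMinima.rowMinimaProg_spec hR h1 h2
  refine ⟨t, s, hexec, ?_, hs⟩
  have h3 : n + (RowMinima.allIntervals R).length + 1 ≤ (k + 1) * (n + m + 1) := by nlinarith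
  calc t ≤ 2700 * (n + (RowMinima.allIntervals R).length + 1) := by omega
    _ ≤ 2700 * ((k + 1) * (n + m + 1)) := Nat.mul_le_mul_left _ h3
    _ = 2700 * (k + 1) * (n + m + 1) := by ring
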